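/- All vector spaces are real. For a finite-dimensional vector space $V$ let $\lambda(V)=\Lambda^{\dim V}V$ and $\lambda^*(V)=\lambda(V)^*$; for a nonzero element $v$ of a line $L$ let $v^*\in L^*$ be the functional with $v^*(v)=1$. A short exact sequence $0\to V'\xrightarrow{i}V\xrightarrow{j}V''\to0$ of finite-dimensional vector spaces induces the isomorphism $$\wedge_V:\lambda(V')\otimes\lambda(V'')\to\lambda(V),\qquad (v'_1\wedge\dots\wedge v'_k)\otimes(j(v_1)\wedge\dots\wedge j(v_\ell))\mapsto i(v'_1)\wedge\dots\wedge i(v'_k)\wedge v_1\wedge\dots\wedge v_\ell .$$ For a Fredholm operator $D:X\to Y$ between Banach spaces let $\kappa(D)=\ker D$, $\mathfrak c(D)=Y/\operatorname{Im}D$, $\operatorname{ind}D=\dim\kappa(D)-\dim\mathfrak c(D)$ and $\lambda(D)=\lambda(\kappa(D))\otimes\lambda^*(\mathfrak c(D))$. For Fredholm operators $D_1:X_1\to X_2$ and $D_2:X_2\to X_3$ let $\delta:\kappa(D_2)\to\mathfrak c(D_1)$, $\delta(x)=-x+\operatorname{Im}D_1$, let $$\epsilon_{D_1,D_2}=(\operatorname{ind}D_2)\dim\mathfrak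 c(D_1)+\big(\dim\mathfrak c(D_1)+\dim\mathfrak c(D_2)\big)\dim(\operatorname{Im}\delta),$$ and let $\widetilde{\mathcal C}_{D_1,D_2}:\lambda(D_1)\otimes\lambda(D_2)\to\lambda(D_2\circ D_1)$ be the unique linear isomorphism such that $$\widetilde{\mathcal C}_{D_1,D_2}\big(x\otimes(v\wedge_{\mathfrak c(D_1)}w)^*\otimes(\lambda(D_1)u\wedge_{\kappa(D_2)}v)\otimes y^*\big)=(-1)^{\epsilon_{D_1,D_2}}\,(x\wedge_{\kappa(D_2D_1)}u)\otimes(\lambda(D_2)w\wedge_{\mathfrak c(D_2D_1)}y)^*$$ for all nonzero $x\in\lambda(\kappa(D_1))$, $u\in\lambda\big(\kappa(D_2D_1)/\kappa(D_1)\big)$, $v\in\lambda\big(\kappa(D_2)/(\kappa(D_2)\cap\operatorname{Im}D_1)\big)$, $w\in\lambda\big(X_2/(\kappa(D_2)+\operatorname{Im}D_1)\big)$, $y\in\lambda(\mathfrak c(D_2))$. Here the wedge isomorphisms are those of the short exact sequences $$0\to\kappa(D_1)\to\kappa(D_2D_1)\to\tfrac{\kappa(D_2D_1)}{\kappa(D_1)}\to0,\qquad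 0\to\tfrac{\kappa(D_2D_1)}{\kappa(D_1)}\xrightarrow{D_1}\kappa(D_2)\to\tfrac{\kappa(D_2)}{\kappa(D_2)\cap\operatorname{Im}D_1}\to0,$$ $$0\to\tfrac{\kappa(D_2)}{\kappa(D_2)\cap\operatorname{Im}D_1}\to\mathfrak c(D_1)\to\tfrac{X_2}{\kappa(D_2)+\operatorname{Im}D_1}\to0,\qquad 0\to\tfrac{X_2}{\kappa(D_2)+\operatorname{Im}D_1}\xrightarrow{D_2}\mathfrak c(D_2D_1)\to\mathfrak c(D_2)\to0 .$$ Proposition. Let $X_1,X_2,X_3,X_4$ be Banach spaces and let $D_1:X_1\to X_2$, $D_2:X_2\to X_3$, $D_3:X_3\to X_4$ be Fredholm operators. Then $$\widetilde{\mathcal C}_{D_2D_1,D_3}\circ(\widetilde{\mathcal C}_{D_1,D_2}\otimes\mathrm{id})=\widetilde{\mathcal C}_{D_1,D_3D_2}\circ(\mathrm{id}\otimes\widetilde{\mathcal C}_{D_2,D_3})$$ as maps $\lambda(D_1)\otimes\lambda(D_2)\otimes\lambda(D_3)\to\lambda(D_3D_2D_1)$. -/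

import Mathlib

noncomputable section

namespace FredholmDet

open Module
open scoped TensorProduct

/-! ### Top exterior powers and the wedge isomorphism of a short exact sequence -/

/-- The top exterior power `λ(V)` of a finite-dimensional real vector space `V`. -/
abbrev TopExt (V : Type*) [AddCommGroup V] [Module ℝ V] : Type _ :=
  ⋀[ℝ]^(finrank ℝ V) V

open Classical in
/-- For a nonzero vector `v` of a line `L`, the functional `v^*` on `L` with `v^*(v) = 1`. -/
def dualVec {L : Type*} [AddCommGroup L] [Module ℝ L] (v : L) : Dual ℝ L :=
  if h : ∃! α : Dual ℝ L, α v = 1 then h.exists.choose else 0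

section Line

variable {L : Type*} [AddCommGroup L] [Module ℝ L]

theorem exists_linearEquiv_apply_eq {M : Type*} [AddCommGroup M] [Module ℝ M]
    (hL : finrank ℝ L = 1) (hM : finrank ℝ M = 1) {v : L} (hv : v ≠ 0) {w : M} (hw : w ≠ 0) :
    ∃ e : L ≃ₗ[ℝ] M, e v = w := by
  have := Module.finite_of_finrank_eq_succ hL
  have := Module.finite_of_finrank_eq_succ hM
  let e : L ≃ₗ[ℝ] M := LinearEquiv.ofFinrankEq L M (hL.trans hM.symm)
  obtain ⟨c, hc⟩ := exists_smul_eq_of_finrank_eq_one hM (e.map_ne_zero_iff.2 hv) w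
  have hc0 : c ≠ 0 := by rintro rfl; exact hw (by simpa using hc.symm)
  exact ⟨e ≪≫ₗ LinearEquiv.smulOfNeZero ℝ M c hc0, by simpa using hc⟩

theorem exists_ne_zero_of_line (hL : finrank ℝ L = 1) : ∃ v : L, v ≠ 0 := by
  have := Module.finite_of_finrank_eq_succ hL
  exact finrank_pos_iff_exists_ne_zero.1 (hL ▸ one_pos)

theorem existsUnique_dual (hL : finrank ℝ L = 1) {v : L} (hv : v ≠ 0) :
    ∃! α : Dual ℝ L, α v = 1 := by
  obtain ⟨e, he⟩ := exists_linearEquiv_apply_eq hL (finrank_self ℝ) hv one_ne_zero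
  refine ⟨e.toLinearMap, he, fun β hβ => LinearMap.ext fun w => ?_⟩
  obtain ⟨c, rfl⟩ := exists_smul_eq_of_finrank_eq_one hL hv w
  simp [hβ, he]

theorem dualVec_apply_self (hL : finrank ℝ L = 1) {v : L} (hv : v ≠ 0) : dualVec v v = 1 := by
  rw [dualVec, dif_pos (existsUnique_dual hL hv)]
  exact (existsUnique_dual hL hv).exists.choose_spec

theorem dualVec_ne_zero (hL : finrank ℝ L = 1) {v : L} (hv : v ≠ 0) : dualVec v ≠ 0 := by
  intro h
  have := dualVec_apply_self hL hv
  simp [h] at this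

theorem dualVec_smul (hL : finrank ℝ L = 1) {v : L} (hv : v ≠ 0) {c : ℝ} (hc : c ≠ 0) :
    dualVec (c • v) = c⁻¹ • dualVec v := by
  have hcv : c • v ≠ 0 := smul_ne_zero hc hv
  refine (existsUnique_dual hL hcv).unique (dualVec_apply_self hL hcv) ?_
  simp [dualVec_apply_self hL hv, hc]

theorem finrank_topExt (V : Type*) [AddCommGroup V] [Module ℝ V] [FiniteDimensional ℝ V] :
    finrank ℝ (TopExt V) = 1 := by
  rw [exteriorPower.finrank_eq, Nat.choose_self]

theorem map_mem_exteriorPower {V W : Type*} [AddCommGroup V] [Module ℝ V] [AddCommGroup W]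
    [Module ℝ W] (f : V →ₗ[ℝ] W) {n : ℕ} {a : ExteriorAlgebra ℝ V} (ha : a ∈ ⋀[ℝ]^n V) :
    ExteriorAlgebra.map f a ∈ ⋀[ℝ]^n W := by
  rw [← ExteriorAlgebra.ιMulti_span_fixedDegree] at ha ⊢
  induction ha using Submodule.span_induction with
  | mem x hx =>
    obtain ⟨v, rfl⟩ := hx
    rw [ExteriorAlgebra.map_apply_ιMulti]
    exact Submodule.subset_span ⟨_, rfl⟩
  | zero => simp
  | add x y _ _ hx hy => rw [map_add]; exact add_mem hx hy
  | smul c x _ hx => rw [map_smul]; exact Submodule.smul_mem _ c hx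

theorem ιMulti_ne_zero {V : Type*} [AddCommGroup V] [Module ℝ V] [FiniteDimensional ℝ V]
    {v : Fin (finrank ℝ V) → V} (hv : LinearIndependent ℝ v) :
    ExteriorAlgebra.ιMulti ℝ (finrank ℝ V) v ≠ 0 := by
  intro h0
  let b := Basis.mk hv (hv.span_eq_top_of_card_eq_finrank' (by simp)).ge
  have hb : ⇑b = v := Basis.coe_mk _ _
  have h1 : b.det v = 1 := by rw [← hb]; exact b.det_self
  have h2 := exteriorPower.alternatingMapLinearEquiv_apply_ιMulti b.det v
  have h3 : exteriorPower.ιMulti ℝ (finrank ℝ V) v = 0 := Subtype.ext h0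
  rw [h3, map_zero, h1] at h2
  exact zero_ne_one h2

theorem tmul_ne_zero {L M : Type*} [AddCommGroup L] [Module ℝ L] [AddCommGroup M] [Module ℝ M]
    (hL : finrank ℝ L = 1) (hM : finrank ℝ M = 1) {a : L} (ha : a ≠ 0) {b : M} (hb : b ≠ 0) :
    a ⊗ₜ[ℝ] b ≠ 0 := by
  obtain ⟨e, he⟩ := exists_linearEquiv_apply_eq hL (finrank_self ℝ) ha one_ne_zero
  obtain ⟨f, hf⟩ := exists_linearEquiv_apply_eq hM (finrank_self ℝ) hb one_ne_zero
  intro h0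
  have := congrArg (TensorProduct.lid ℝ ℝ ∘ TensorProduct.map e.toLinearMap f.toLinearMap) h0
  simp [he, hf] at this

theorem finrank_dual (hL : finrank ℝ L = 1) : finrank ℝ (Dual ℝ L) = 1 := by
  rw [Subspace.dual_finrank_eq, hL]

/-- The formula for composition isomorphisms does not depend on the choice of generators. -/
theorem existsUnique_of_lines {A U V W Y B C B' C' : Type*}
    [AddCommGroup A] [Module ℝ A] [AddCommGroup U] [Module ℝ U] [AddCommGroup V] [Module ℝ V]
    [AddCommGroup W] [Module ℝ W] [AddCommGroup Y] [Module ℝ Y] [AddCommGroup B] [Module ℝ B]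
    [AddCommGroup C] [Module ℝ C] [AddCommGroup B'] [Module ℝ B'] [AddCommGroup C'] [Module ℝ C']
    (hA : finrank ℝ A = 1) (hU : finrank ℝ U = 1) (hV : finrank ℝ V = 1) (hW : finrank ℝ W = 1)
    (hY : finrank ℝ Y = 1) (hB : finrank ℝ B = 1) (hC : finrank ℝ C = 1) (hB' : finrank ℝ B' = 1)
    (hC' : finrank ℝ C' = 1)
    (f : V →ₗ[ℝ] W →ₗ[ℝ] C) (g : U →ₗ[ℝ] V →ₗ[ℝ] B) (f' : A →ₗ[ℝ] U →ₗ[ℝ] B')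
    (g' : W →ₗ[ℝ] Y →ₗ[ℝ] C')
    (hf : ∀ {v w}, v ≠ 0 → w ≠ 0 → f v w ≠ 0) (hg : ∀ {u v}, u ≠ 0 → v ≠ 0 → g u v ≠ 0)
    (hf' : ∀ {x u}, x ≠ 0 → u ≠ 0 → f' x u ≠ 0) (hg' : ∀ {w y}, w ≠ 0 → y ≠ 0 → g' w y ≠ 0)
    {s : ℝ} (hs : s ≠ 0) :
    ∃! e : ((A ⊗[ℝ] Dual ℝ C) ⊗[ℝ] (B ⊗[ℝ] Dual ℝ Y)) ≃ₗ[ℝ] B' ⊗[ℝ] Dual ℝ C',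
      ∀ (x : A) (u : U) (v : V) (w : W) (y : Y), x ≠ 0 → u ≠ 0 → v ≠ 0 → w ≠ 0 → y ≠ 0 →
        e ((x ⊗ₜ dualVec (f v w)) ⊗ₜ (g u v ⊗ₜ dualVec y)) =
          s • (f' x u ⊗ₜ dualVec (g' w y)) := by
  obtain ⟨x₀, hx₀⟩ := exists_ne_zero_of_line hA
  obtain ⟨u₀, hu₀⟩ := exists_ne_zero_of_line hU
  obtain ⟨v₀, hv₀⟩ := exists_ne_zero_of_line hV
  obtain ⟨w₀, hw₀⟩ := exists_ne_zero_of_line hW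
  obtain ⟨y₀, hy₀⟩ := exists_ne_zero_of_line hY
  have h1 : finrank ℝ (A ⊗[ℝ] Dual ℝ C) = 1 := by
    rw [finrank_tensorProduct, hA, finrank_dual hC]
  have h2 : finrank ℝ (B ⊗[ℝ] Dual ℝ Y) = 1 := by
    rw [finrank_tensorProduct, hB, finrank_dual hY]
  have h3 : finrank ℝ (B' ⊗[ℝ] Dual ℝ C') = 1 := by
    rw [finrank_tensorProduct, hB', finrank_dual hC']
  have h12 : finrank ℝ ((A ⊗[ℝ] Dual ℝ C) ⊗[ℝ] (B ⊗[ℝ] Dual ℝ Y)) = 1 := by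
    rw [finrank_tensorProduct, h1, h2]
  have hvw := hf hv₀ hw₀
  have hwy := hg' hw₀ hy₀
  have hsrc : (x₀ ⊗ₜ[ℝ] dualVec (f v₀ w₀)) ⊗ₜ[ℝ] (g u₀ v₀ ⊗ₜ[ℝ] dualVec y₀) ≠ 0 :=
    tmul_ne_zero h1 h2 (tmul_ne_zero hA (finrank_dual hC) hx₀ (dualVec_ne_zero hC hvw))
      (tmul_ne_zero hB (finrank_dual hY) (hg hu₀ hv₀) (dualVec_ne_zero hY hy₀))
  have htgt : s • (f' x₀ u₀ ⊗ₜ[ℝ] dualVec (g' w₀ y₀)) ≠ 0 :=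
    smul_ne_zero hs
      (tmul_ne_zero hB' (finrank_dual hC') (hf' hx₀ hu₀) (dualVec_ne_zero hC' hwy))
  obtain ⟨e, he⟩ := exists_linearEquiv_apply_eq h12 h3 hsrc htgt
  refine ⟨e, ?_, ?_⟩
  · intro x u v w y _ _ hv hw hy
    obtain ⟨a, rfl⟩ := exists_smul_eq_of_finrank_eq_one hA hx₀ x
    obtain ⟨b, rfl⟩ := exists_smul_eq_of_finrank_eq_one hU hu₀ u
    obtain ⟨c, rfl⟩ := exists_smul_eq_of_finrank_eq_one hV hv₀ v
    obtain ⟨d, rfl⟩ := exists_smul_eq_of_finrank_eq_one hW hw₀ w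
    obtain ⟨k, rfl⟩ := exists_smul_eq_of_finrank_eq_one hY hy₀ y
    have hc0 : c ≠ 0 := by rintro rfl; simp at hv
    have hd0 : d ≠ 0 := by rintro rfl; simp at hw
    have hk0 : k ≠ 0 := by rintro rfl; simp at hy
    have e1 : f (c • v₀) (d • w₀) = (c * d) • f v₀ w₀ := by simp [smul_smul, mul_comm]
    have e2 : g (b • u₀) (c • v₀) = (b * c) • g u₀ v₀ := by simp [smul_smul, mul_comm]
    have e3 : f' (a • x₀) (b • u₀) = (a * b) • f' x₀ u₀ := by simp [smul_smul, mul_comm]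
    have e4 : g' (d • w₀) (k • y₀) = (d * k) • g' w₀ y₀ := by simp [smul_smul, mul_comm]
    rw [e1, e2, e3, e4, dualVec_smul hC hvw (mul_ne_zero hc0 hd0), dualVec_smul hY hy₀ hk0,
      dualVec_smul hC' hwy (mul_ne_zero hd0 hk0)]
    simp only [TensorProduct.tmul_smul, ← TensorProduct.smul_tmul', smul_smul, map_smul, he]
    congr 1
    field_simp
  · intro e' he'
    ext1 t
    obtain ⟨c, rfl⟩ := exists_smul_eq_of_finrank_eq_one h12 hsrc t
    rw [map_smul, map_smul, he, he' x₀ u₀ v₀ w₀ y₀ hx₀ hu₀ hv₀ hw₀ hy₀]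

end Line

section ShortExact

variable {V' V V'' : Type*} [AddCommGroup V'] [Module ℝ V'] [AddCommGroup V] [Module ℝ V]
  [AddCommGroup V''] [Module ℝ V'']

/-- `0 → V' → V → V'' → 0` is a short exact sequence of finite-dimensional vector spaces. -/
structure IsShortExact (i : V' →ₗ[ℝ] V) (j : V →ₗ[ℝ] V'') : Prop where
  finite : FiniteDimensional ℝ V
  injective : Function.Injective i
  exact : Function.Exact i j
  surjective : Function.Surjective j

variable {i : V' →ₗ[ℝ] V} {j : V →ₗ[ℝ] V''}

theorem IsShortExact.finite_left (h : IsShortExact i j) : FiniteDimensional ℝ V' :=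
  have := h.finite
  FiniteDimensional.of_injective i h.injective

theorem IsShortExact.finite_right (h : IsShortExact i j) : FiniteDimensional ℝ V'' :=
  have := h.finite
  Module.Finite.of_surjective j h.surjective

theorem IsShortExact.finrank_eq (h : IsShortExact i j) :
    finrank ℝ V' + finrank ℝ V'' = finrank ℝ V := by
  have := h.finite
  have h1 := LinearMap.finrank_range_add_finrank_ker j
  rw [LinearMap.range_eq_top.2 h.surjective, finrank_top, h.exact.linearMap_ker_eq,
    LinearMap.finrank_range_of_inj h.injective] at h1
  omega

/-- A linear right inverse of the surjection in a short exact sequence. -/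
def IsShortExact.section (h : IsShortExact i j) : V'' →ₗ[ℝ] V :=
  (j.exists_rightInverse_of_surjective (LinearMap.range_eq_top.2 h.surjective)).choose

theorem IsShortExact.comp_section (h : IsShortExact i j) : j ∘ₗ h.section = LinearMap.id :=
  (j.exists_rightInverse_of_surjective (LinearMap.range_eq_top.2 h.surjective)).choose_spec

theorem IsShortExact.mul_mem (h : IsShortExact i j) (a : TopExt V') (b : TopExt V'') :
    ExteriorAlgebra.map i (a : ExteriorAlgebra ℝ V') *
      ExteriorAlgebra.map h.section (b : ExteriorAlgebra ℝ V'') ∈ ⋀[ℝ]^(finrank ℝ V) V := by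
  rw [← h.finrank_eq]
  exact SetLike.mul_mem_graded (A := fun n : ℕ => ⋀[ℝ]^n V)
    (map_mem_exteriorPower i a.2) (map_mem_exteriorPower h.section b.2)

/-- The map `∧_V : λ(V') ⊗ λ(V'') → λ(V)`, in curried form, which sends
`(v'₁ ∧ … ∧ v'ₖ) ⊗ (j v₁ ∧ … ∧ j vₗ)` to `i v'₁ ∧ … ∧ i v'ₖ ∧ v₁ ∧ … ∧ vₗ`.
The product does not depend on the lift of the second factor to `V`. -/
def IsShortExact.wedge (h : IsShortExact i j) :
    TopExt V' →ₗ[ℝ] TopExt V'' →ₗ[ℝ] TopExt V :=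
  LinearMap.mk₂ ℝ (fun a b => ⟨_, h.mul_mem a b⟩)
    (fun _ _ _ => Subtype.ext (by simp [add_mul]))
    (fun _ _ _ => Subtype.ext (by simp))
    (fun _ _ _ => Subtype.ext (by simp [mul_add]))
    (fun _ _ _ => Subtype.ext (by simp))

theorem IsShortExact.wedge_ne_zero (h : IsShortExact i j) {a : TopExt V'} {b : TopExt V''}
    (ha : a ≠ 0) (hb : b ≠ 0) : h.wedge a b ≠ 0 := by
  have := h.finite
  have := h.finite_left
  have := h.finite_right
  let e' := finBasis ℝ V'
  let e'' := finBasis ℝ V''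
  let a₀ : TopExt V' := exteriorPower.ιMulti ℝ _ e'
  let b₀ : TopExt V'' := exteriorPower.ιMulti ℝ _ e''
  have ha₀ : a₀ ≠ 0 := fun h0 => ιMulti_ne_zero e'.linearIndependent (congrArg Subtype.val h0)
  have hb₀ : b₀ ≠ 0 := fun h0 => ιMulti_ne_zero e''.linearIndependent (congrArg Subtype.val h0)
  obtain ⟨c, rfl⟩ := exists_smul_eq_of_finrank_eq_one (finrank_topExt V') ha₀ a
  obtain ⟨d, rfl⟩ := exists_smul_eq_of_finrank_eq_one (finrank_topExt V'') hb₀ b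
  have hc : c ≠ 0 := by rintro rfl; simp at ha
  have hd : d ≠ 0 := by rintro rfl; simp at hb
  suffices hk : h.wedge a₀ b₀ ≠ 0 by
    simpa [hc, hd] using hk
  intro h0
  have h1 : ExteriorAlgebra.map i (ExteriorAlgebra.ιMulti ℝ _ e') *
      ExteriorAlgebra.map h.section (ExteriorAlgebra.ιMulti ℝ _ e'') = 0 :=
    congrArg Subtype.val h0
  rw [ExteriorAlgebra.map_apply_ιMulti, ExteriorAlgebra.map_apply_ιMulti,
    ExteriorAlgebra.ιMulti_mul_ιMulti] at h1
  have hinj : LinearMap.ker (i.coprod h.section) = ⊥ := by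
    rw [LinearMap.ker_eq_bot']
    rintro ⟨p, q⟩ hpq
    have hpq' : i p + h.section q = 0 := by simpa using hpq
    have hq : q = 0 := by
      have h2 := congrArg j hpq'
      rw [map_add, h.exact.apply_apply_eq_zero, zero_add, map_zero] at h2
      rw [← h2]
      exact (LinearMap.congr_fun h.comp_section q).symm
    subst hq
    have hp : p = 0 := h.injective (by simpa using hpq')
    rw [hp]; rfl
  have hli := ((e'.prod e'').linearIndependent.map' _ hinj).comp _ finSumFinEquiv.symm.injective
  have heq : (⇑(i.coprod h.section) ∘ ⇑(e'.prod e'')) ∘ ⇑finSumFinEquiv.symm =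
      Fin.append (⇑i ∘ ⇑e') (⇑h.section ∘ ⇑e'') := by
    ext k
    refine Fin.addCases (fun l => ?_) (fun l => ?_) k <;> simp
  rw [heq] at hli
  revert h1 hli
  generalize Fin.append (⇑i ∘ ⇑e') (⇑h.section ∘ ⇑e'') = f
  revert f
  rw [h.finrank_eq]
  exact fun f h1 hli => ιMulti_ne_zero hli h1

end ShortExact

/-! ### Determinant lines and composition isomorphisms of Fredholm operators -/

section Fredholm

variable {X₁ X₂ X₃ : Type*} [NormedAddCommGroup X₁] [NormedSpace ℝ X₁]
  [NormedAddCommGroup X₂] [NormedSpace ℝ X₂] [NormedAddCommGroup X₃] [NormedSpace ℝ X₃]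

/-- The determinant line `λ(D) = λ(ker D) ⊗ λ(coker D)^*`. -/
abbrev DetLine (D : X₁ →L[ℝ] X₂) : Type _ :=
  TopExt D.ker ⊗[ℝ] Dual ℝ (TopExt (X₂ ⧸ D.range))

/-- The index of `D`. -/
def index (D : X₁ →L[ℝ] X₂) : ℤ :=
  (finrank ℝ D.ker : ℤ) - (finrank ℝ (X₂ ⧸ D.range) : ℤ)

theorem isFredholm_comp {D₁ : X₁ →L[ℝ] X₂} {D₂ : X₂ →L[ℝ] X₃}
    (h₁ : D₁.IsFredholm) (h₂ : D₂.IsFredholm) : (D₂ ∘L D₁).IsFredholm := by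
  obtain ⟨E₁, hE₁⟩ := h₁.exists_isQuasiInverse
  obtain ⟨E₂, hE₂⟩ := h₂.exists_isQuasiInverse
  exact .of_isQuasiInverse (v := E₁ ∘L E₂) (hE₁.comp hE₂)

variable (D₁ : X₁ →L[ℝ] X₂) (D₂ : X₂ →L[ℝ] X₃)

/-! The six-term exact sequence of the composition,
`0 → ker D₁ → ker (D₂ D₁) → ker D₂ → coker D₁ → coker (D₂ D₁) → coker D₂ → 0`,
whose second map is `D₁`, whose third map is `δ`, and whose fourth map is induced by `D₂`,
splits into four short exact sequences with the following three intermediate spaces. -/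

/-- `δ : ker D₂ → coker D₁`, `δ(x) = -x + Im D₁`. -/
def connecting : D₂.ker →ₗ[ℝ] X₂ ⧸ D₁.range :=
  -(D₁.range.mkQ ∘ₗ D₂.ker.subtype)

/-- `ker (D₂ D₁) / ker D₁`. -/
abbrev KerQuot : Type _ := (D₂ ∘L D₁).ker ⧸ D₁.ker.submoduleOf (D₂ ∘L D₁).ker

/-- `ker D₂ / (ker D₂ ∩ Im D₁)`. -/
abbrev MidQuot : Type _ := D₂.ker ⧸ D₁.range.submoduleOf D₂.ker

/-- `X₂ / (ker D₂ + Im D₁)`. -/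
abbrev CokerQuot : Type _ := X₂ ⧸ (D₂.ker ⊔ D₁.range)

/-- The inclusion `ker D₁ → ker (D₂ D₁)`. -/
def kerIncl : D₁.ker →ₗ[ℝ] (D₂ ∘L D₁).ker :=
  Submodule.inclusion fun x hx => by
    have hx' : D₁ x = 0 := hx
    simp [hx']

/-- The injection `ker (D₂ D₁) / ker D₁ → ker D₂` induced by `D₁`. -/
def kerQuotMap : KerQuot D₁ D₂ →ₗ[ℝ] D₂.ker :=
  (D₁.ker.submoduleOf (D₂ ∘L D₁).ker).liftQ
    (D₁.toLinearMap.restrict (p := (D₂ ∘L D₁).ker) (q := D₂.ker) fun _ hx => hx)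
    fun _ hx => Subtype.ext hx

/-- The injection `ker D₂ / (ker D₂ ∩ Im D₁) → coker D₁` induced by the inclusion. -/
def midQuotMap : MidQuot D₁ D₂ →ₗ[ℝ] X₂ ⧸ D₁.range :=
  (D₁.range.submoduleOf D₂.ker).mapQ D₁.range D₂.ker.subtype fun _ hx => hx

/-- The projection `coker D₁ → X₂ / (ker D₂ + Im D₁)`. -/
def cokerProj : X₂ ⧸ D₁.range →ₗ[ℝ] CokerQuot D₁ D₂ :=
  Submodule.factor le_sup_right

/-- The injection `X₂ / (ker D₂ + Im D₁) → coker (D₂ D₁)` induced by `D₂`. -/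
def cokerQuotMap : CokerQuot D₁ D₂ →ₗ[ℝ] X₃ ⧸ (D₂ ∘L D₁).range :=
  (D₂.ker ⊔ D₁.range).mapQ (D₂ ∘L D₁).range D₂.toLinearMap <| by
    refine sup_le (fun x hx => ?_) ?_
    · have hx' : D₂ x = 0 := hx
      simp [hx']
    · rintro _ ⟨x, rfl⟩
      exact ⟨x, rfl⟩

/-- The projection `coker (D₂ D₁) → coker D₂`. -/
def cokerCompProj : X₃ ⧸ (D₂ ∘L D₁).range →ₗ[ℝ] X₃ ⧸ D₂.range :=
  Submodule.factor <| by
    rintro _ ⟨x, rfl⟩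
    exact ⟨D₁ x, rfl⟩

variable {D₁ D₂}

/-- `0 → ker D₁ → ker (D₂ D₁) → ker (D₂ D₁) / ker D₁ → 0` -/
theorem kerComp_shortExact (h₁ : D₁.IsFredholm) (h₂ : D₂.IsFredholm) :
    IsShortExact (kerIncl D₁ D₂) (D₁.ker.submoduleOf (D₂ ∘L D₁).ker).mkQ where
  finite := (isFredholm_comp h₁ h₂).finite_ker
  injective := Submodule.inclusion_injective _
  exact := by
    intro y
    rw [Submodule.mkQ_apply, Submodule.Quotient.mk_eq_zero]
    constructor
    · exact fun hy => ⟨⟨y, hy⟩, rfl⟩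
    · rintro ⟨x, rfl⟩
      exact x.2
  surjective := Submodule.mkQ_surjective _

/-- `0 → ker (D₂ D₁) / ker D₁ → ker D₂ → ker D₂ / (ker D₂ ∩ Im D₁) → 0` -/
theorem ker_shortExact (h₂ : D₂.IsFredholm) :
    IsShortExact (kerQuotMap D₁ D₂) (D₁.range.submoduleOf D₂.ker).mkQ where
  finite := h₂.finite_ker
  injective := by
    rw [← LinearMap.ker_eq_bot, kerQuotMap, Submodule.ker_liftQ_eq_bot']
    ext x
    exact ⟨fun hx => Subtype.ext hx, fun hx => congrArg Subtype.val hx⟩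
  exact := by
    intro y
    rw [Submodule.mkQ_apply, Submodule.Quotient.mk_eq_zero]
    constructor
    · rintro ⟨x, hx⟩
      have hx' : D₁ x = y := hx
      refine ⟨Submodule.Quotient.mk ⟨x, ?_⟩, Subtype.ext hx'⟩
      simp [hx']
    · rintro ⟨x, rfl⟩
      obtain ⟨x, rfl⟩ := Submodule.Quotient.mk_surjective _ x
      exact ⟨x, rfl⟩
  surjective := Submodule.mkQ_surjective _

/-- `0 → ker D₂ / (ker D₂ ∩ Im D₁) → coker D₁ → X₂ / (ker D₂ + Im D₁) → 0` -/
theorem coker_shortExact (h₁ : D₁.IsFredholm) :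
    IsShortExact (midQuotMap D₁ D₂) (cokerProj D₁ D₂) where
  finite := h₁.finite_coker
  injective := by
    rw [← LinearMap.ker_eq_bot]
    refine Submodule.ker_liftQ_eq_bot' _ (D₁.range.mkQ ∘ₗ D₂.ker.subtype) ?_
    ext x
    simp [Submodule.submoduleOf]
  exact := by
    intro y
    obtain ⟨y, rfl⟩ := Submodule.Quotient.mk_surjective _ y
    change (Submodule.Quotient.mk y : CokerQuot D₁ D₂) = 0 ↔ _
    rw [Submodule.Quotient.mk_eq_zero, Submodule.mem_sup]
    constructor
    · rintro ⟨k, hk, r, hr, rfl⟩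
      refine ⟨Submodule.Quotient.mk ⟨k, hk⟩, ?_⟩
      refine (Submodule.Quotient.eq _).2 ?_
      simpa using hr
    · rintro ⟨k, hk⟩
      obtain ⟨k, rfl⟩ := Submodule.Quotient.mk_surjective _ k
      have hk' := (Submodule.Quotient.eq _).1 hk.symm
      exact ⟨k, k.2, y - k, hk', by simp⟩
  surjective := by
    intro y
    obtain ⟨y, rfl⟩ := Submodule.Quotient.mk_surjective _ y
    exact ⟨Submodule.Quotient.mk y, rfl⟩

/-- `0 → X₂ / (ker D₂ + Im D₁) → coker (D₂ D₁) → coker D₂ → 0` -/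
theorem cokerComp_shortExact (h₁ : D₁.IsFredholm) (h₂ : D₂.IsFredholm) :
    IsShortExact (cokerQuotMap D₁ D₂) (cokerCompProj D₁ D₂) where
  finite := (isFredholm_comp h₁ h₂).finite_coker
  injective := by
    rw [← LinearMap.ker_eq_bot]
    refine Submodule.ker_liftQ_eq_bot' _ ((D₂ ∘L D₁).range.mkQ ∘ₗ D₂.toLinearMap) ?_
    ext x
    simp only [LinearMap.mem_ker, LinearMap.comp_apply, Submodule.mkQ_apply,
      Submodule.Quotient.mk_eq_zero]
    rw [Submodule.mem_sup]
    constructor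
    · rintro ⟨k, hk, _, ⟨z, rfl⟩, rfl⟩
      have hk' : D₂ k = 0 := hk
      exact ⟨z, by simp [hk']⟩
    · rintro ⟨z, hz⟩
      have hz' : D₂ (D₁ z) = D₂ x := hz
      refine ⟨x - D₁ z, ?_, D₁ z, ⟨z, rfl⟩, by simp⟩
      simp [hz']
  exact := by
    intro y
    obtain ⟨y, rfl⟩ := Submodule.Quotient.mk_surjective _ y
    change (Submodule.Quotient.mk y : X₃ ⧸ D₂.range) = 0 ↔ _
    rw [Submodule.Quotient.mk_eq_zero]
    constructor
    · rintro ⟨x, rfl⟩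
      exact ⟨Submodule.Quotient.mk x, rfl⟩
    · rintro ⟨x, hx⟩
      obtain ⟨x, rfl⟩ := Submodule.Quotient.mk_surjective _ x
      obtain ⟨z, hz⟩ := (Submodule.Quotient.eq _).1 hx.symm
      have hz' : D₂ (D₁ z) = y - D₂ x := hz
      exact ⟨x + D₁ z, by simp [hz']⟩
  surjective := by
    intro y
    obtain ⟨y, rfl⟩ := Submodule.Quotient.mk_surjective _ y
    exact ⟨Submodule.Quotient.mk y, rfl⟩

variable (D₁ D₂) in
/-- The exponent `(ind D₂) dim(coker D₁) + (dim(coker D₁) + dim(coker D₂)) dim(Im δ)`. -/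
def signExp : ℤ :=
  index D₂ * finrank ℝ (X₂ ⧸ D₁.range) +
    (finrank ℝ (X₂ ⧸ D₁.range) + finrank ℝ (X₃ ⧸ D₂.range)) *
      finrank ℝ (LinearMap.range (connecting D₁ D₂))

/-- The formula that characterizes the composition isomorphism:
`x ⊗ (v ∧ w)^* ⊗ (D₁ u ∧ v) ⊗ y^* ↦ (-1)^ε (x ∧ u) ⊗ (D₂ w ∧ y)^*`. -/
def IsCompIso (h₁ : D₁.IsFredholm) (h₂ : D₂.IsFredholm)
    (C : (DetLine D₁ ⊗[ℝ] DetLine D₂) ≃ₗ[ℝ] DetLine (D₂ ∘L D₁)) : Prop :=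
  ∀ (x : TopExt D₁.ker) (u : TopExt (KerQuot D₁ D₂)) (v : TopExt (MidQuot D₁ D₂))
    (w : TopExt (CokerQuot D₁ D₂)) (y : TopExt (X₃ ⧸ D₂.range)),
    x ≠ 0 → u ≠ 0 → v ≠ 0 → w ≠ 0 → y ≠ 0 →
    C ((x ⊗ₜ dualVec ((coker_shortExact h₁).wedge v w)) ⊗ₜ
        ((ker_shortExact h₂).wedge u v ⊗ₜ dualVec y)) =
      (-1 : ℝ) ^ signExp D₁ D₂ •
        ((kerComp_shortExact h₁ h₂).wedge x u ⊗ₜ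
          dualVec ((cokerComp_shortExact h₁ h₂).wedge w y))

theorem existsUnique_isCompIso (h₁ : D₁.IsFredholm) (h₂ : D₂.IsFredholm) :
    ∃! C, IsCompIso h₁ h₂ C := by
  have s₁ := kerComp_shortExact h₁ h₂
  have s₂ := ker_shortExact (D₁ := D₁) h₂
  have s₃ := coker_shortExact (D₂ := D₂) h₁
  have s₄ := cokerComp_shortExact h₁ h₂
  have := s₁.finite
  have := s₂.finite
  have := s₃.finite
  have := s₄.finite
  have := s₁.finite_left
  have := s₁.finite_right
  have := s₃.finite_left
  have := s₃.finite_right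
  have := s₄.finite_right
  exact existsUnique_of_lines (finrank_topExt _) (finrank_topExt _) (finrank_topExt _)
    (finrank_topExt _) (finrank_topExt _) (finrank_topExt _) (finrank_topExt _)
    (finrank_topExt _) (finrank_topExt _) _ _ _ _ s₃.wedge_ne_zero s₂.wedge_ne_zero
    s₁.wedge_ne_zero s₄.wedge_ne_zero (zpow_ne_zero _ (by norm_num))

/-- The composition isomorphism `C̃_{D₁,D₂} : λ(D₁) ⊗ λ(D₂) → λ(D₂ D₁)`. -/
def compIso (h₁ : D₁.IsFredholm) (h₂ : D₂.IsFredholm) :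
    (DetLine D₁ ⊗[ℝ] DetLine D₂) ≃ₗ[ℝ] DetLine (D₂ ∘L D₁) :=
  (existsUnique_isCompIso h₁ h₂).exists.choose

theorem compIso_spec (h₁ : D₁.IsFredholm) (h₂ : D₂.IsFredholm) :
    IsCompIso h₁ h₂ (compIso h₁ h₂) :=
  (existsUnique_isCompIso h₁ h₂).exists.choose_spec

end Fredholm

end FredholmDet

end

/-!
Write `K(D)` for `ker D` and `C(D)` for `coker D`. The sequence `X₁ → X₂ → X₃ → X₄` given by `D₁`,
`D₂`, `D₃` is a representation of a linear quiver and hence a sum of interval representations.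
Except for the interval that runs through all four spaces, each interval has finite multiplicity.
The nine multiplicity spaces are realized here as subquotients, and a generator of the top exterior
power of each of them is denoted by a letter:

* `a`, `b`, `c`: vectors of `X₁` that die in `X₂`, `X₃`, `X₄`;
* `d`, `e`, `f`: vectors of `X₂` outside the image of `D₁` that die in `X₃`, in `X₄`, nowhere;
* `g`, `h`: vectors of `X₃` outside the image of `D₂` that die in `X₄`, nowhere;
* `k`: vectors of `X₄` outside the image of `D₃`.

In terms of these, the determinant lines are generated by wedge products, for instance
`K(D₂) = b ∧ d`, `C(D₁) = d ∧ e ∧ f`, `K(D₃ D₂) = b ∧ d ∧ c ∧ e`. Since all lines are one-dimensional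
it suffices to compare both composites on
`a ⊗ (d ∧ e ∧ f)^* ⊗ (b ∧ d) ⊗ (g ∧ h)^* ⊗ (c ∧ e ∧ g) ⊗ k^*`, and both send it to
`± (a ∧ b ∧ c) ⊗ (f ∧ h ∧ k)^*`.

Regrouping the factors is governed by two facts about nested short exact sequences: wedge products
are associative along a filtration (`wedge_assoc`), and the two ways of reading a `3 × 3` diagram
differ by the sign of moving one middle factor past the other (`wedge_wedge_comm`). The exchange
occurs once on each side: `f` and `g` in `C(D₂ D₁)`, and `c` and `d` in `K(D₃ D₂)`. Together with
the signs in the definition of the composition isomorphisms the total signs are equal, which is a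
polynomial identity modulo `2` in the nine dimensions (`neg_one_zpow_signExp`).
-/

noncomputable section

namespace FredholmDet

open Module
open scoped TensorProduct

/-! ### Graded commutativity and top degree elements of the exterior algebra -/

section Exterior

variable {V W U : Type*} [AddCommGroup V] [Module ℝ V] [AddCommGroup W] [Module ℝ W]
  [AddCommGroup U] [Module ℝ U]

theorem map_map (f : V →ₗ[ℝ] W) (g : W →ₗ[ℝ] U) (x : ExteriorAlgebra ℝ V) :
    ExteriorAlgebra.map g (ExteriorAlgebra.map f x) = ExteriorAlgebra.map (g ∘ₗ f) x :=
  AlgHom.congr_fun (ExteriorAlgebra.map_comp_map f g) x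

theorem ι_mul_comm (v : V) {n : ℕ} {y : ExteriorAlgebra ℝ V} (hy : y ∈ ⋀[ℝ]^n V) :
    ExteriorAlgebra.ι ℝ v * y = (-1 : ℝ) ^ n • (y * ExteriorAlgebra.ι ℝ v) := by
  induction hy using Submodule.pow_induction_on_left' with
  | algebraMap r => simp [Algebra.commutes]
  | add x y i _ _ hx hy => rw [mul_add, hx, hy, add_mul, smul_add]
  | mem_mul m hm i x _ hx =>
    obtain ⟨w, rfl⟩ := hm
    rw [← mul_assoc, eq_neg_of_add_eq_zero_left (ExteriorAlgebra.ι_add_mul_swap v w), neg_mul,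
      mul_assoc, hx, mul_smul_comm, ← mul_assoc, pow_succ, mul_neg_one, neg_smul]

theorem mul_comm_of_mem {m n : ℕ} {x y : ExteriorAlgebra ℝ V} (hx : x ∈ ⋀[ℝ]^m V)
    (hy : y ∈ ⋀[ℝ]^n V) : x * y = (-1 : ℝ) ^ (m * n) • (y * x) := by
  induction hx using Submodule.pow_induction_on_left' with
  | algebraMap r => simp [Algebra.commutes]
  | add a b i _ _ ha hb => rw [add_mul, ha, hb, mul_add, smul_add]
  | mem_mul v hv i x _ hx =>
    obtain ⟨v, rfl⟩ := hv
    rw [mul_assoc, hx, mul_smul_comm, ← mul_assoc, ι_mul_comm v hy, smul_mul_assoc, smul_smul,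
      mul_assoc, Nat.succ_mul, pow_add]

theorem topExt_mul_ι [FiniteDimensional ℝ V] (a : TopExt V) (v : V) :
    (a : ExteriorAlgebra ℝ V) * ExteriorAlgebra.ι ℝ v = 0 := by
  have hmem : (a : ExteriorAlgebra ℝ V) * ExteriorAlgebra.ι ℝ v ∈ ⋀[ℝ]^(finrank ℝ V + 1) V := by
    change _ ∈ LinearMap.range (ExteriorAlgebra.ι ℝ : V →ₗ[ℝ] _) ^ (finrank ℝ V + 1)
    rw [pow_succ]
    exact Submodule.mul_mem_mul a.2 ⟨v, rfl⟩
  have h0 : finrank ℝ (⋀[ℝ]^(finrank ℝ V + 1) V) = 0 := by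
    rw [exteriorPower.finrank_eq, Nat.choose_succ_self]
  rw [Submodule.finrank_eq_zero] at h0
  rwa [h0, Submodule.mem_bot] at hmem

/-- If right multiplication by `ι (v - f v)` annihilates `A` for every `v`, then `A * β` does not
change when `f` is applied to `β`. -/
theorem mul_map_eq_of_forall {f : V →ₗ[ℝ] V} {A : ExteriorAlgebra ℝ V}
    (hA : ∀ v, A * ExteriorAlgebra.ι ℝ (v - f v) = 0) (β : ExteriorAlgebra ℝ V) :
    A * ExteriorAlgebra.map f β = A * β := by
  -- The annihilation is carried along in the induction: it passes from `A` to `A * β`.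
  suffices H : ∀ A : ExteriorAlgebra ℝ V, (∀ v, A * ExteriorAlgebra.ι ℝ (v - f v) = 0) →
      A * ExteriorAlgebra.map f β = A * β ∧ ∀ v, A * β * ExteriorAlgebra.ι ℝ (v - f v) = 0 from
    (H A hA).1
  clear hA A
  induction β using ExteriorAlgebra.induction with
  | algebraMap r =>
    refine fun A hA => ⟨by simp, fun v => ?_⟩
    rw [← Algebra.commutes, mul_assoc, hA, mul_zero]
  | ι w =>
    refine fun A hA => ⟨?_, fun v => ?_⟩
    · have := hA w
      rw [map_sub, mul_sub, sub_eq_zero] at this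
      rw [ExteriorAlgebra.map_apply_ι, this]
    · rw [mul_assoc, eq_neg_of_add_eq_zero_left (ExteriorAlgebra.ι_add_mul_swap w _), mul_neg,
        ← mul_assoc, hA, zero_mul, neg_zero]
  | mul x y hx hy =>
    intro A hA
    obtain ⟨hx₁, hx₂⟩ := hx A hA
    obtain ⟨hy₁, hy₂⟩ := hy (A * x) hx₂
    rw [map_mul, ← mul_assoc, ← mul_assoc, hx₁]
    exact ⟨hy₁, hy₂⟩
  | add x y hx hy =>
    refine fun A hA => ⟨by rw [map_add, mul_add, mul_add, (hx A hA).1, (hy A hA).1], fun v => ?_⟩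
    rw [mul_add, add_mul, (hx A hA).2, (hy A hA).2, add_zero]

end Exterior

/-! ### Wedge isomorphisms of nested short exact sequences -/

section Wedge

theorem IsShortExact.apply_section {V' V V'' : Type*} [AddCommGroup V'] [Module ℝ V']
    [AddCommGroup V] [Module ℝ V] [AddCommGroup V''] [Module ℝ V''] {i : V' →ₗ[ℝ] V}
    {j : V →ₗ[ℝ] V''} (h : IsShortExact i j) (v : V'') : j (h.section v) = v :=
  LinearMap.congr_fun h.comp_section v

/-- The second factor of a wedge product may be lifted to any element of the exterior algebra of
the middle space, homogeneous or not. -/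
theorem IsShortExact.coe_wedge {V' V V'' : Type*} [AddCommGroup V'] [Module ℝ V']
    [AddCommGroup V] [Module ℝ V] [AddCommGroup V''] [Module ℝ V''] {i : V' →ₗ[ℝ] V}
    {j : V →ₗ[ℝ] V''} (h : IsShortExact i j) (a : TopExt V') (b : TopExt V'')
    {β : ExteriorAlgebra ℝ V} (hβ : ExteriorAlgebra.map j β = b) :
    (h.wedge a b : ExteriorAlgebra ℝ V) = ExteriorAlgebra.map i a * β := by
  have := h.finite_left
  change ExteriorAlgebra.map i (a : ExteriorAlgebra ℝ V') *
      ExteriorAlgebra.map h.section (b : ExteriorAlgebra ℝ V'') = _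
  rw [← hβ, map_map]
  refine mul_map_eq_of_forall (fun v => ?_) β
  obtain ⟨u, hu⟩ := (h.exact (v - (h.section ∘ₗ j) v)).1 (by simp [h.apply_section])
  rw [← hu, ← ExteriorAlgebra.map_apply_ι, ← map_mul, topExt_mul_ι, map_zero]

variable {A B C D AB AC BC BD CD M : Type*} [AddCommGroup A] [Module ℝ A]
  [AddCommGroup B] [Module ℝ B] [AddCommGroup C] [Module ℝ C] [AddCommGroup D] [Module ℝ D]
  [AddCommGroup AB] [Module ℝ AB] [AddCommGroup AC] [Module ℝ AC] [AddCommGroup BC] [Module ℝ BC]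
  [AddCommGroup BD] [Module ℝ BD] [AddCommGroup CD] [Module ℝ CD] [AddCommGroup M] [Module ℝ M]

/-- Associativity of the wedge product for a two-step filtration `A ⊆ AB ⊆ M` with graded pieces
`A`, `B`, `C`, where `BC = M / A`. -/
theorem wedge_assoc {iA : A →ₗ[ℝ] AB} {jB : AB →ₗ[ℝ] B} {iAB : AB →ₗ[ℝ] M} {jC : M →ₗ[ℝ] C}
    {iB : B →ₗ[ℝ] BC} {jC' : BC →ₗ[ℝ] C} {iA' : A →ₗ[ℝ] M} {jBC : M →ₗ[ℝ] BC}
    (hAB : IsShortExact iA jB) (hAB' : IsShortExact iAB jC)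
    (hBC : IsShortExact iB jC') (hBC' : IsShortExact iA' jBC)
    (eA : iAB ∘ₗ iA = iA') (eB : jBC ∘ₗ iAB = iB ∘ₗ jB) (eC : jC' ∘ₗ jBC = jC)
    (a : TopExt A) (b : TopExt B) (c : TopExt C) :
    hAB'.wedge (hAB.wedge a b) c = hBC'.wedge a (hBC.wedge b c) := by
  have e₁ : jBC ∘ₗ iAB ∘ₗ hAB.section = iB := by
    rw [← LinearMap.comp_assoc, eB, LinearMap.comp_assoc, hAB.comp_section, LinearMap.comp_id]
  have e₂ : jC' ∘ₗ jBC ∘ₗ hAB'.section = LinearMap.id := by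
    rw [← LinearMap.comp_assoc, eC, hAB'.comp_section]
  have h : ExteriorAlgebra.map jBC
      (ExteriorAlgebra.map (iAB ∘ₗ hAB.section) (b : ExteriorAlgebra ℝ B) *
        ExteriorAlgebra.map hAB'.section (c : ExteriorAlgebra ℝ C)) = hBC.wedge b c := by
    rw [hBC.coe_wedge b c (β := ExteriorAlgebra.map (jBC ∘ₗ hAB'.section) c)
      (by rw [map_map, e₂, ExteriorAlgebra.map_id, AlgHom.id_apply]), map_mul, map_map, map_map, e₁]
  refine Subtype.ext ?_
  rw [hBC'.coe_wedge _ _ h]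
  change ExteriorAlgebra.map iAB (ExteriorAlgebra.map iA (a : ExteriorAlgebra ℝ A) *
    ExteriorAlgebra.map hAB.section (b : ExteriorAlgebra ℝ B)) * _ = _
  rw [map_mul, map_map, map_map, eA, mul_assoc]

/-- Exchange of the two middle factors of a wedge product, for a `3 × 3` diagram with short exact
rows and columns, corners `A`, `B`, `C`, `D` and centre `M`. -/
theorem wedge_wedge_comm {iA : A →ₗ[ℝ] AB} {jB : AB →ₗ[ℝ] B} {iC : C →ₗ[ℝ] CD} {jD : CD →ₗ[ℝ] D}
    {iAB : AB →ₗ[ℝ] M} {jCD : M →ₗ[ℝ] CD}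
    {iA' : A →ₗ[ℝ] AC} {jC : AC →ₗ[ℝ] C} {iB : B →ₗ[ℝ] BD} {jD' : BD →ₗ[ℝ] D}
    {iAC : AC →ₗ[ℝ] M} {jBD : M →ₗ[ℝ] BD}
    (hAB : IsShortExact iA jB) (hCD : IsShortExact iC jD) (hM : IsShortExact iAB jCD)
    (hAC : IsShortExact iA' jC) (hBD : IsShortExact iB jD') (hM' : IsShortExact iAC jBD)
    (eA : iAB ∘ₗ iA = iAC ∘ₗ iA') (eB : jBD ∘ₗ iAB = iB ∘ₗ jB) (eC : jCD ∘ₗ iAC = iC ∘ₗ jC)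
    (eD : jD ∘ₗ jCD = jD' ∘ₗ jBD)
    (a : TopExt A) (b : TopExt B) (c : TopExt C) (d : TopExt D) :
    hM.wedge (hAB.wedge a b) (hCD.wedge c d) =
      (-1 : ℝ) ^ (finrank ℝ B * finrank ℝ C) •
        hM'.wedge (hAC.wedge a c) (hBD.wedge b d) := by
  let σ : D →ₗ[ℝ] M := hM.section ∘ₗ hCD.section
  have e₁ : jCD ∘ₗ iAC ∘ₗ hAC.section = iC := by
    rw [← LinearMap.comp_assoc, eC, LinearMap.comp_assoc, hAC.comp_section, LinearMap.comp_id]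
  have e₂ : jBD ∘ₗ iAB ∘ₗ hAB.section = iB := by
    rw [← LinearMap.comp_assoc, eB, LinearMap.comp_assoc, hAB.comp_section, LinearMap.comp_id]
  have e₃ : jD ∘ₗ jCD ∘ₗ σ = LinearMap.id := by
    ext x
    simp [σ, IsShortExact.apply_section]
  have e₄ : jD' ∘ₗ jBD ∘ₗ σ = LinearMap.id := by
    rw [← e₃, ← LinearMap.comp_assoc, ← eD, LinearMap.comp_assoc]
  have h₁ : ExteriorAlgebra.map jCD
      (ExteriorAlgebra.map (iAC ∘ₗ hAC.section) (c : ExteriorAlgebra ℝ C) *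
        ExteriorAlgebra.map σ (d : ExteriorAlgebra ℝ D)) = hCD.wedge c d := by
    rw [hCD.coe_wedge c d (β := ExteriorAlgebra.map (jCD ∘ₗ σ) d)
      (by rw [map_map, e₃, ExteriorAlgebra.map_id, AlgHom.id_apply]), map_mul, map_map, map_map, e₁]
  have h₂ : ExteriorAlgebra.map jBD
      (ExteriorAlgebra.map (iAB ∘ₗ hAB.section) (b : ExteriorAlgebra ℝ B) *
        ExteriorAlgebra.map σ (d : ExteriorAlgebra ℝ D)) = hBD.wedge b d := by
    rw [hBD.coe_wedge b d (β := ExteriorAlgebra.map (jBD ∘ₗ σ) d)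
      (by rw [map_map, e₄, ExteriorAlgebra.map_id, AlgHom.id_apply]), map_mul, map_map, map_map, e₂]
  refine Subtype.ext ?_
  rw [Submodule.coe_smul, hM.coe_wedge _ _ h₁, hM'.coe_wedge _ _ h₂]
  change ExteriorAlgebra.map iAB (ExteriorAlgebra.map iA (a : ExteriorAlgebra ℝ A) *
    ExteriorAlgebra.map hAB.section (b : ExteriorAlgebra ℝ B)) * _ =
    _ • (ExteriorAlgebra.map iAC (ExteriorAlgebra.map iA' (a : ExteriorAlgebra ℝ A) *
    ExteriorAlgebra.map hAC.section (c : ExteriorAlgebra ℝ C)) * _)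
  have hbc := mul_comm_of_mem (map_mem_exteriorPower (iAB ∘ₗ hAB.section) b.2)
    (map_mem_exteriorPower (iAC ∘ₗ hAC.section) c.2)
  rw [map_mul, map_map, map_map, map_mul, map_map, map_map, eA, mul_assoc, ← mul_assoc _ _
    (ExteriorAlgebra.map σ _), hbc, smul_mul_assoc, mul_smul_comm, mul_assoc, mul_assoc]

end Wedge

/-! ### Composites of isomorphisms between lines -/

theorem dualVec_neg_one_pow_smul {L : Type*} [AddCommGroup L] [Module ℝ L]
    (hL : finrank ℝ L = 1) {v : L} (hv : v ≠ 0) (n : ℕ) :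
    dualVec ((-1 : ℝ) ^ n • v) = (-1 : ℝ) ^ n • dualVec v := by
  rw [dualVec_smul hL hv (pow_ne_zero _ (by norm_num)), ← inv_pow, inv_neg_one]

theorem exists_ne_zero_topExt (V : Type*) [AddCommGroup V] [Module ℝ V] [FiniteDimensional ℝ V] :
    ∃ v : TopExt V, v ≠ 0 :=
  exists_ne_zero_of_line (finrank_topExt V)

theorem tmul_dualVec_neg_one_pow_smul {L M : Type*} [AddCommGroup L] [Module ℝ L] [AddCommGroup M]
    [Module ℝ M] (hM : finrank ℝ M = 1) (a : L) {b b' : M} (hb : b ≠ 0) {n : ℕ}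
    (h : b' = (-1 : ℝ) ^ n • b) : a ⊗ₜ[ℝ] dualVec b' = (-1 : ℝ) ^ n • (a ⊗ₜ[ℝ] dualVec b) := by
  rw [h, dualVec_neg_one_pow_smul hM hb, TensorProduct.tmul_smul]

theorem exists_smul_tmul_dualVec_eq {L M : Type*} [AddCommGroup L] [Module ℝ L] [AddCommGroup M]
    [Module ℝ M] (hL : finrank ℝ L = 1) (hM : finrank ℝ M = 1) {a : L} (ha : a ≠ 0) {b : M}
    (hb : b ≠ 0) (x : L ⊗[ℝ] Dual ℝ M) : ∃ c : ℝ, c • (a ⊗ₜ[ℝ] dualVec b) = x :=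
  exists_smul_eq_of_finrank_eq_one (by rw [finrank_tensorProduct, hL, finrank_dual hM])
    (tmul_ne_zero hL (finrank_dual hM) ha (dualVec_ne_zero hM hb)) x

/-- Two ways of composing isomorphisms of lines along the two bracketings of a triple tensor product
agree as soon as they agree on one generator. The lines are only assumed to be additive monoids, as
these are the structures that occur in the types of the composition isomorphisms. -/
theorem congr_trans_eq_of_apply_tmul {L₁ L₂ L₃ L₁₂ L₂₃ L : Type*}
    [AddCommMonoid L₁] [Module ℝ L₁] [AddCommMonoid L₂] [Module ℝ L₂]
    [AddCommMonoid L₃] [Module ℝ L₃] [AddCommMonoid L₁₂] [Module ℝ L₁₂]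
    [AddCommMonoid L₂₃] [Module ℝ L₂₃] [AddCommMonoid L] [Module ℝ L]
    {C₁₂ : (L₁ ⊗[ℝ] L₂) ≃ₗ[ℝ] L₁₂} {C : (L₁₂ ⊗[ℝ] L₃) ≃ₗ[ℝ] L}
    {C₂₃ : (L₂ ⊗[ℝ] L₃) ≃ₗ[ℝ] L₂₃} {C' : (L₁ ⊗[ℝ] L₂₃) ≃ₗ[ℝ] L}
    {v₁ : L₁} {v₂ : L₂} {v₃ : L₃} {v₁₂ : L₁₂} {v₂₃ : L₂₃} {v : L} {s t r s' t' r' : ℝ}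
    (hv₁ : ∀ x, ∃ c : ℝ, c • v₁ = x) (hv₂ : ∀ x, ∃ c : ℝ, c • v₂ = x)
    (hv₃ : ∀ x, ∃ c : ℝ, c • v₃ = x)
    (h₁₂ : C₁₂ (v₁ ⊗ₜ v₂) = s • r • v₁₂) (h : C (v₁₂ ⊗ₜ v₃) = t • v)
    (h₂₃ : C₂₃ (v₂ ⊗ₜ v₃) = s' • r' • v₂₃) (h' : C' (v₁ ⊗ₜ v₂₃) = t' • v)
    (hst : s * t * r = s' * t' * r') :
    TensorProduct.congr C₁₂ (LinearEquiv.refl ℝ L₃) ≪≫ₗ C =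
      TensorProduct.assoc ℝ L₁ L₂ L₃ ≪≫ₗ
        TensorProduct.congr (LinearEquiv.refl ℝ L₁) C₂₃ ≪≫ₗ C' := by
  refine LinearEquiv.toLinearMap_injective (TensorProduct.ext_threefold fun x y z => ?_)
  obtain ⟨a, rfl⟩ := hv₁ x
  obtain ⟨b, rfl⟩ := hv₂ y
  obtain ⟨c, rfl⟩ := hv₃ z
  simp only [LinearEquiv.coe_coe, LinearEquiv.trans_apply, TensorProduct.congr_tmul,
    TensorProduct.assoc_tmul, LinearEquiv.refl_apply, h₁₂, h₂₃, ← TensorProduct.smul_tmul',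
    TensorProduct.tmul_smul, map_smul, h, h', smul_smul]
  congr 1
  linear_combination a * b * c * hst

/-! ### Short exact sequences attached to a triple of Fredholm operators -/

/-- A linear map `f : U → V` induces a short exact sequence `0 → U / p → V / q → V / r → 0` when
`p = f⁻¹ q` and `r = q + Im f`. -/
theorem isShortExact_mapQ {U V : Type*} [AddCommGroup U] [Module ℝ U] [AddCommGroup V]
    [Module ℝ V] {p : Submodule ℝ U} {q r : Submodule ℝ V} {f : U →ₗ[ℝ] V} {hf : p ≤ q.comap f}
    {hqr : q ≤ r.comap LinearMap.id} (hfin : FiniteDimensional ℝ (V ⧸ q))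
    (hp : ∀ u, f u ∈ q → u ∈ p) (hr : ∀ u, f u ∈ r) (hr' : ∀ v ∈ r, ∃ u, v - f u ∈ q) :
    IsShortExact (p.mapQ q f hf) (q.mapQ r LinearMap.id hqr) where
  finite := hfin
  injective := by
    rw [injective_iff_map_eq_zero]
    intro u hu
    obtain ⟨u, rfl⟩ := p.mkQ_surjective u
    exact (Submodule.Quotient.mk_eq_zero _).2 (hp u ((Submodule.Quotient.mk_eq_zero _).1 hu))
  exact := by
    intro v
    obtain ⟨v, rfl⟩ := q.mkQ_surjective v
    refine (Submodule.Quotient.mk_eq_zero _).trans ⟨fun hv => ?_, ?_⟩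
    · obtain ⟨u, hu⟩ := hr' v hv
      exact ⟨p.mkQ u, ((Submodule.Quotient.eq _).2 hu).symm⟩
    · rintro ⟨u, hu⟩
      obtain ⟨u, rfl⟩ := p.mkQ_surjective u
      have h := add_mem (hqr ((Submodule.Quotient.eq _).1 hu.symm)) (hr u)
      rwa [sub_add_cancel] at h
  surjective := by
    intro w
    obtain ⟨w, rfl⟩ := r.mkQ_surjective w
    exact ⟨q.mkQ w, rfl⟩

section Triple

variable {X₁ X₂ X₃ X₄ : Type*} [NormedAddCommGroup X₁] [NormedSpace ℝ X₁]
  [NormedAddCommGroup X₂] [NormedSpace ℝ X₂] [NormedAddCommGroup X₃] [NormedSpace ℝ X₃]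
  [NormedAddCommGroup X₄] [NormedSpace ℝ X₄]
  (D₁ : X₁ →L[ℝ] X₂) (D₂ : X₂ →L[ℝ] X₃) (D₃ : X₃ →L[ℝ] X₄)

/-- `ker (D₃ D₂) / (ker (D₃ D₂) ∩ (ker D₂ + Im D₁))`: the part of `X₂` that is not hit by `D₁`,
survives `D₂` and is killed by `D₃`. -/
abbrev CentreQuot : Type _ :=
  (D₃ ∘L D₂).ker ⧸ (D₂.ker ⊔ D₁.range).submoduleOf (D₃ ∘L D₂).ker

theorem ker_le_ker_comp : D₁.ker ≤ (D₂ ∘L D₁).ker := fun x hx => (kerIncl D₁ D₂ ⟨x, hx⟩).2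

theorem range_comp_le : (D₂ ∘L D₁).range ≤ D₂.range := by
  rintro _ ⟨x, rfl⟩
  exact ⟨D₁ x, rfl⟩

theorem mem_ker_sup_range_iff {x : X₂} : x ∈ D₂.ker ⊔ D₁.range ↔ D₂ x ∈ (D₂ ∘L D₁).range := by
  rw [Submodule.mem_sup]
  constructor
  · rintro ⟨y, hy, _, ⟨z, rfl⟩, rfl⟩
    have hy' : D₂ y = 0 := hy
    exact ⟨z, by simp [hy']⟩
  · rintro ⟨z, hz⟩
    have hz' : D₂ (D₁ z) = D₂ x := hz
    exact ⟨x - D₁ z, by simp [hz'], D₁ z, ⟨z, rfl⟩, by simp⟩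

/-- `ker (D₂ D₁) / ker D₁ → ker (D₃ D₂ D₁) / ker D₁` -/
def kerQuotIncl : KerQuot D₁ D₂ →ₗ[ℝ] KerQuot D₁ (D₃ ∘L D₂) :=
  Submodule.mapQ _ _ (kerIncl (D₂ ∘L D₁) D₃) fun _ hx => hx

/-- `ker (D₃ D₂ D₁) / ker D₁ → ker (D₃ D₂ D₁) / ker (D₂ D₁)` -/
def kerQuotProj : KerQuot D₁ (D₃ ∘L D₂) →ₗ[ℝ] KerQuot (D₂ ∘L D₁) D₃ :=
  Submodule.mapQ _ _ LinearMap.id fun _ hx => ker_le_ker_comp D₁ D₂ hx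

/-- `ker (D₃ D₂ D₁) / ker (D₂ D₁) → ker (D₃ D₂) / ker D₂`, induced by `D₁` -/
def kerQuotMapLeft : KerQuot (D₂ ∘L D₁) D₃ →ₗ[ℝ] KerQuot D₂ D₃ :=
  Submodule.mapQ _ _ (D₁.toLinearMap.restrict (p := (D₃ ∘L D₂ ∘L D₁).ker) (q := (D₃ ∘L D₂).ker)
    fun _ hx => hx) fun _ hx => hx

/-- `ker (D₃ D₂) / ker D₂ → ker (D₃ D₂) / (ker (D₃ D₂) ∩ (ker D₂ + Im D₁))` -/
def kerQuotToCentre : KerQuot D₂ D₃ →ₗ[ℝ] CentreQuot D₁ D₂ D₃ :=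
  Submodule.mapQ _ _ LinearMap.id fun _ hx => Submodule.mem_sup_left hx

/-- `ker D₂ / (ker D₂ ∩ Im D₁) → ker (D₃ D₂) / (ker (D₃ D₂) ∩ Im D₁)` -/
def midQuotIncl : MidQuot D₁ D₂ →ₗ[ℝ] MidQuot D₁ (D₃ ∘L D₂) :=
  Submodule.mapQ _ _ (kerIncl D₂ D₃) fun _ hx => hx

/-- `ker (D₃ D₂) / (ker (D₃ D₂) ∩ Im D₁) → ker (D₃ D₂) / (ker (D₃ D₂) ∩ (ker D₂ + Im D₁))` -/
def midQuotToCentre : MidQuot D₁ (D₃ ∘L D₂) →ₗ[ℝ] CentreQuot D₁ D₂ D₃ :=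
  Submodule.mapQ _ _ LinearMap.id fun _ hx => Submodule.mem_sup_right hx

/-- `ker (D₃ D₂) / (ker (D₃ D₂) ∩ (ker D₂ + Im D₁)) → X₂ / (ker D₂ + Im D₁)` -/
def centreToCokerQuot : CentreQuot D₁ D₂ D₃ →ₗ[ℝ] CokerQuot D₁ D₂ :=
  Submodule.mapQ _ _ (D₃ ∘L D₂).ker.subtype fun _ hx => hx

/-- `X₂ / (ker D₂ + Im D₁) → X₂ / (ker (D₃ D₂) + Im D₁)` -/
def cokerQuotProj : CokerQuot D₁ D₂ →ₗ[ℝ] CokerQuot D₁ (D₃ ∘L D₂) :=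
  Submodule.mapQ _ _ LinearMap.id <| sup_le_sup_right (ker_le_ker_comp D₂ D₃) _

/-- `ker (D₃ D₂) / (ker (D₃ D₂) ∩ (ker D₂ + Im D₁)) → ker D₃ / (ker D₃ ∩ Im (D₂ D₁))`, induced
by `D₂` -/
def centreToMidQuot : CentreQuot D₁ D₂ D₃ →ₗ[ℝ] MidQuot (D₂ ∘L D₁) D₃ :=
  Submodule.mapQ _ _ (D₂.toLinearMap.restrict (p := (D₃ ∘L D₂).ker) (q := D₃.ker) fun _ hx => hx)
    fun _ hx => (mem_ker_sup_range_iff D₁ D₂).1 hx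

/-- `ker D₃ / (ker D₃ ∩ Im (D₂ D₁)) → ker D₃ / (ker D₃ ∩ Im D₂)` -/
def midQuotProj : MidQuot (D₂ ∘L D₁) D₃ →ₗ[ℝ] MidQuot D₂ D₃ :=
  Submodule.mapQ _ _ LinearMap.id fun _ hx => range_comp_le D₁ D₂ hx

/-- `X₂ / (ker (D₃ D₂) + Im D₁) → X₃ / (ker D₃ + Im (D₂ D₁))`, induced by `D₂` -/
def cokerQuotMapRight : CokerQuot D₁ (D₃ ∘L D₂) →ₗ[ℝ] CokerQuot (D₂ ∘L D₁) D₃ :=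
  Submodule.mapQ _ _ D₂.toLinearMap fun _ hx =>
    (mem_ker_sup_range_iff (D₂ ∘L D₁) D₃).2 ((mem_ker_sup_range_iff D₁ (D₃ ∘L D₂)).1 hx)

/-- `X₃ / (ker D₃ + Im (D₂ D₁)) → X₃ / (ker D₃ + Im D₂)` -/
def cokerQuotProjRight : CokerQuot (D₂ ∘L D₁) D₃ →ₗ[ℝ] CokerQuot D₂ D₃ :=
  Submodule.mapQ _ _ LinearMap.id <| sup_le_sup_left (range_comp_le D₁ D₂) _

variable {D₁ D₂ D₃}

theorem kerQuot_shortExact (h₁ : D₁.IsFredholm) (h₂ : D₂.IsFredholm) (h₃ : D₃.IsFredholm) :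
    IsShortExact (kerQuotIncl D₁ D₂ D₃) (kerQuotProj D₁ D₂ D₃) :=
  isShortExact_mapQ (kerComp_shortExact h₁ (isFredholm_comp h₂ h₃)).finite_right
    (fun _ hu => hu) (fun u => u.2)
    fun v hv => ⟨⟨v, hv⟩, by
      change (v : X₁) - v ∈ D₁.ker
      rw [sub_self]
      exact zero_mem _⟩

theorem kerQuotMapLeft_shortExact (h₂ : D₂.IsFredholm) (h₃ : D₃.IsFredholm) :
    IsShortExact (kerQuotMapLeft D₁ D₂ D₃) (kerQuotToCentre D₁ D₂ D₃) :=
  isShortExact_mapQ (kerComp_shortExact h₂ h₃).finite_right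
    (fun _ hu => hu) (fun u => Submodule.mem_sup_right ⟨u, rfl⟩) (by
      rintro ⟨v, hv⟩ hv'
      obtain ⟨z, hz⟩ := (mem_ker_sup_range_iff D₁ D₂).1 hv'
      have hz' : D₂ (D₁ z) = D₂ v := hz
      have hv₃ : D₃ (D₂ v) = 0 := hv
      refine ⟨⟨z, ?_⟩, ?_⟩
      · change D₃ (D₂ (D₁ z)) = 0
        rw [hz', hv₃]
      · change D₂ (v - D₁ z) = 0
        rw [map_sub, hz', sub_self])

theorem midQuotIncl_shortExact (h₂ : D₂.IsFredholm) (h₃ : D₃.IsFredholm) :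
    IsShortExact (midQuotIncl D₁ D₂ D₃) (midQuotToCentre D₁ D₂ D₃) :=
  isShortExact_mapQ (ker_shortExact (isFredholm_comp h₂ h₃)).finite_right
    (fun _ hu => hu) (fun u => Submodule.mem_sup_left u.2) (by
      rintro ⟨v, hv⟩ hv'
      obtain ⟨k, hk, y, hy, hky⟩ := Submodule.mem_sup.1 hv'
      refine ⟨⟨k, hk⟩, ?_⟩
      change v - k ∈ D₁.range
      have hky' : k + y = v := hky
      rwa [← hky', add_sub_cancel_left])

theorem cokerQuot_shortExact (h₁ : D₁.IsFredholm) :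
    IsShortExact (centreToCokerQuot D₁ D₂ D₃) (cokerQuotProj D₁ D₂ D₃) :=
  isShortExact_mapQ (coker_shortExact h₁).finite_right
    (fun _ hu => hu) (fun u => Submodule.mem_sup_left u.2) (by
      intro v hv
      obtain ⟨k, hk, y, hy, rfl⟩ := Submodule.mem_sup.1 hv
      refine ⟨⟨k, hk⟩, ?_⟩
      change k + y - k ∈ _
      rw [add_sub_cancel_left]
      exact Submodule.mem_sup_right hy)

theorem centreToMidQuot_shortExact (h₃ : D₃.IsFredholm) :
    IsShortExact (centreToMidQuot D₁ D₂ D₃) (midQuotProj D₁ D₂ D₃) :=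
  isShortExact_mapQ (ker_shortExact h₃).finite_right
    (fun _ hu => (mem_ker_sup_range_iff D₁ D₂).2 hu) (fun u => ⟨u, rfl⟩) (by
      rintro ⟨_, hv⟩ ⟨u, rfl⟩
      refine ⟨⟨u, hv⟩, ?_⟩
      change D₂ u - D₂ u ∈ (D₂ ∘L D₁).range
      rw [sub_self]
      exact zero_mem _)

theorem cokerQuotMapRight_shortExact (h₁ : D₁.IsFredholm) (h₂ : D₂.IsFredholm) :
    IsShortExact (cokerQuotMapRight D₁ D₂ D₃) (cokerQuotProjRight D₁ D₂ D₃) :=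
  isShortExact_mapQ (coker_shortExact (isFredholm_comp h₁ h₂)).finite_right
    (fun _ hu => (mem_ker_sup_range_iff D₁ (D₃ ∘L D₂)).2
      ((mem_ker_sup_range_iff (D₂ ∘L D₁) D₃).1 hu))
    (fun u => Submodule.mem_sup_right ⟨u, rfl⟩) (by
      intro v hv
      obtain ⟨k, hk, _, ⟨y, rfl⟩, rfl⟩ := Submodule.mem_sup.1 hv
      refine ⟨y, ?_⟩
      change k + D₂ y - D₂ y ∈ _
      rw [add_sub_cancel_right]
      exact Submodule.mem_sup_left hk)

/-! ### The sign of the composition isomorphisms -/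

theorem finrank_range_connecting (h₁ : D₁.IsFredholm) :
    finrank ℝ (LinearMap.range (connecting D₁ D₂)) = finrank ℝ (MidQuot D₁ D₂) := by
  have h : LinearMap.range (connecting D₁ D₂) = LinearMap.range (midQuotMap D₁ D₂) := by
    rw [connecting, LinearMap.range_neg]
    exact (Submodule.range_liftQ _ _ _).symm
  rw [h, LinearMap.finrank_range_of_inj (coker_shortExact h₁).injective]

/-- The two sides of the associativity relation carry the same sign: `ε` for the two compositions
on either side, together with the sign of the exchange of factors in the cokernel of `D₂ D₁`
on the left and in the kernel of `D₃ D₂` on the right. -/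
theorem neg_one_zpow_signExp (h₁ : D₁.IsFredholm) (h₂ : D₂.IsFredholm) (h₃ : D₃.IsFredholm) :
    (-1 : ℝ) ^ signExp D₁ D₂ * (-1 : ℝ) ^ signExp (D₂ ∘L D₁) D₃ *
        (-1 : ℝ) ^ (finrank ℝ (CokerQuot D₁ (D₃ ∘L D₂)) * finrank ℝ (MidQuot D₂ D₃)) =
      (-1 : ℝ) ^ signExp D₂ D₃ * (-1 : ℝ) ^ signExp D₁ (D₃ ∘L D₂) *
        (-1 : ℝ) ^ (finrank ℝ (MidQuot D₁ D₂) * finrank ℝ (KerQuot (D₂ ∘L D₁) D₃)) := by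
  have e₁ := (ker_shortExact (D₁ := D₁) h₂).finrank_eq
  have e₂ := (ker_shortExact (D₁ := D₂) h₃).finrank_eq
  have e₃ := (coker_shortExact (D₂ := D₂) h₁).finrank_eq
  have e₄ := (coker_shortExact (D₂ := D₃) h₂).finrank_eq
  have e₅ := (kerComp_shortExact h₂ h₃).finrank_eq
  have e₆ := (cokerComp_shortExact h₁ h₂).finrank_eq
  have e₇ := (cokerComp_shortExact h₂ h₃).finrank_eq
  have e₈ := (kerQuotMapLeft_shortExact (D₁ := D₁) h₂ h₃).finrank_eq
  have e₉ := (midQuotIncl_shortExact (D₁ := D₁) h₂ h₃).finrank_eq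
  have e₁₀ := (cokerQuot_shortExact (D₂ := D₂) (D₃ := D₃) h₁).finrank_eq
  have e₁₁ := (centreToMidQuot_shortExact (D₁ := D₁) (D₂ := D₂) h₃).finrank_eq
  rw [← zpow_natCast, ← zpow_natCast, ← zpow_add₀ (by norm_num), ← zpow_add₀ (by norm_num),
    ← zpow_add₀ (by norm_num), ← zpow_add₀ (by norm_num)]
  simp only [signExp, index, finrank_range_connecting h₁, finrank_range_connecting h₂,
    finrank_range_connecting (isFredholm_comp h₁ h₂)]
  rw [← e₇, ← e₆, ← e₅, ← e₃, ← e₁, ← e₂, ← e₄, ← e₈, ← e₉, ← e₁₀, ← e₁₁]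
  -- After substitution the exponents are integer polynomials in the nine independent dimensions.
  suffices h : ∀ m n t : ℤ, m = n + 2 * t → (-1 : ℝ) ^ m = (-1 : ℝ) ^ n from
    h _ _ ((finrank ℝ (MidQuot D₂ D₃) - finrank ℝ (MidQuot D₁ D₂)) *
        finrank ℝ (CentreQuot D₁ D₂ D₃) +
      finrank ℝ (CokerQuot D₁ (D₃ ∘L D₂)) * finrank ℝ (MidQuot D₂ D₃) -
      finrank ℝ (MidQuot D₁ D₂) * finrank ℝ (KerQuot (D₂ ∘L D₁) D₃)) (by push_cast; ring)
  rintro m n t rfl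
  rw [zpow_add₀ (by norm_num), zpow_mul, even_two.neg_one_zpow, one_zpow, mul_one]

/-! ### Regrouping wedge products in kernels and cokernels -/

/-- `(c ∧ e) ∧ g = c ∧ (e ∧ g)` in `ker D₃`. -/
theorem ker_wedge_assoc (h₂ : D₂.IsFredholm) (h₃ : D₃.IsFredholm)
    (c : TopExt (KerQuot (D₂ ∘L D₁) D₃)) (e : TopExt (CentreQuot D₁ D₂ D₃))
    (g : TopExt (MidQuot D₂ D₃)) :
    (ker_shortExact h₃).wedge ((kerQuotMapLeft_shortExact h₂ h₃).wedge c e) g =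
      (ker_shortExact h₃).wedge c ((centreToMidQuot_shortExact h₃).wedge e g) := by
  refine wedge_assoc _ _ _ _ ?_ ?_ ?_ c e g <;> ext x <;> rfl

/-- `(d ∧ e) ∧ f = d ∧ (e ∧ f)` in `coker D₁`. -/
theorem coker_wedge_assoc (h₁ : D₁.IsFredholm) (h₂ : D₂.IsFredholm) (h₃ : D₃.IsFredholm)
    (d : TopExt (MidQuot D₁ D₂)) (e : TopExt (CentreQuot D₁ D₂ D₃))
    (f : TopExt (CokerQuot D₁ (D₃ ∘L D₂))) :
    (coker_shortExact h₁).wedge ((midQuotIncl_shortExact h₂ h₃).wedge d e) f =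
      (coker_shortExact h₁).wedge d ((cokerQuot_shortExact h₁).wedge e f) := by
  refine wedge_assoc _ _ _ _ ?_ ?_ ?_ d e f <;> ext x <;> rfl

/-- `(a ∧ b) ∧ c = a ∧ (b ∧ c)` in `ker (D₃ D₂ D₁)`. -/
theorem kerComp_wedge_assoc (h₁ : D₁.IsFredholm) (h₂ : D₂.IsFredholm) (h₃ : D₃.IsFredholm)
    (a : TopExt D₁.ker) (b : TopExt (KerQuot D₁ D₂)) (c : TopExt (KerQuot (D₂ ∘L D₁) D₃)) :
    (kerComp_shortExact (isFredholm_comp h₁ h₂) h₃).wedge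
        ((kerComp_shortExact h₁ h₂).wedge a b) c =
      (kerComp_shortExact h₁ (isFredholm_comp h₂ h₃)).wedge a
        ((kerQuot_shortExact h₁ h₂ h₃).wedge b c) := by
  -- The two bracketings of the triple composition have definitionally equal kernels; stating the
  -- last sequence for the first bracketing keeps the unification below syntactic.
  have t : IsShortExact (V := (D₃ ∘L D₂ ∘L D₁).ker) (V'' := KerQuot D₁ (D₃ ∘L D₂))
      (kerIncl D₁ (D₃ ∘L D₂)) (D₁.ker.submoduleOf (D₃ ∘L D₂ ∘L D₁).ker).mkQ :=
    kerComp_shortExact h₁ (isFredholm_comp h₂ h₃)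
  refine wedge_assoc (kerComp_shortExact h₁ h₂) (kerComp_shortExact (isFredholm_comp h₁ h₂) h₃)
    (kerQuot_shortExact h₁ h₂ h₃) t ?_ ?_ ?_ a b c <;> ext x <;> rfl

/-- `(f ∧ h) ∧ k = f ∧ (h ∧ k)` in `coker (D₃ D₂ D₁)`. -/
theorem cokerComp_wedge_assoc (h₁ : D₁.IsFredholm) (h₂ : D₂.IsFredholm) (h₃ : D₃.IsFredholm)
    (f : TopExt (CokerQuot D₁ (D₃ ∘L D₂))) (h : TopExt (CokerQuot D₂ D₃))
    (k : TopExt (X₄ ⧸ D₃.range)) :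
    (cokerComp_shortExact (isFredholm_comp h₁ h₂) h₃).wedge
        ((cokerQuotMapRight_shortExact h₁ h₂).wedge f h) k =
      (cokerComp_shortExact h₁ (isFredholm_comp h₂ h₃)).wedge f
        ((cokerComp_shortExact h₂ h₃).wedge h k) := by
  refine wedge_assoc (cokerQuotMapRight_shortExact h₁ h₂)
    (cokerComp_shortExact (isFredholm_comp h₁ h₂) h₃) (cokerComp_shortExact h₂ h₃)
    (cokerComp_shortExact h₁ (isFredholm_comp h₂ h₃)) ?_ ?_ ?_ f h k <;> ext x <;> rfl

/-- `(b ∧ d) ∧ (c ∧ e) = ± (b ∧ c) ∧ (d ∧ e)` in `ker (D₃ D₂)`. -/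
theorem ker_wedge_comm (h₁ : D₁.IsFredholm) (h₂ : D₂.IsFredholm) (h₃ : D₃.IsFredholm)
    (b : TopExt (KerQuot D₁ D₂)) (d : TopExt (MidQuot D₁ D₂))
    (c : TopExt (KerQuot (D₂ ∘L D₁) D₃)) (e : TopExt (CentreQuot D₁ D₂ D₃)) :
    (kerComp_shortExact h₂ h₃).wedge ((ker_shortExact h₂).wedge b d)
        ((kerQuotMapLeft_shortExact h₂ h₃).wedge c e) =
      (-1 : ℝ) ^ (finrank ℝ (MidQuot D₁ D₂) * finrank ℝ (KerQuot (D₂ ∘L D₁) D₃)) •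
        (ker_shortExact (isFredholm_comp h₂ h₃)).wedge ((kerQuot_shortExact h₁ h₂ h₃).wedge b c)
          ((midQuotIncl_shortExact h₂ h₃).wedge d e) := by
  refine wedge_wedge_comm _ _ _ _ _ _ ?_ ?_ ?_ ?_ b d c e <;> ext x <;> rfl

/-- `(e ∧ f) ∧ (g ∧ h) = ± (e ∧ g) ∧ (f ∧ h)` in `coker (D₂ D₁)`. -/
theorem coker_wedge_comm (h₁ : D₁.IsFredholm) (h₂ : D₂.IsFredholm) (h₃ : D₃.IsFredholm)
    (e : TopExt (CentreQuot D₁ D₂ D₃)) (f : TopExt (CokerQuot D₁ (D₃ ∘L D₂)))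
    (g : TopExt (MidQuot D₂ D₃)) (h : TopExt (CokerQuot D₂ D₃)) :
    (cokerComp_shortExact h₁ h₂).wedge ((cokerQuot_shortExact h₁).wedge e f)
        ((coker_shortExact h₂).wedge g h) =
      (-1 : ℝ) ^ (finrank ℝ (CokerQuot D₁ (D₃ ∘L D₂)) * finrank ℝ (MidQuot D₂ D₃)) •
        (coker_shortExact (isFredholm_comp h₁ h₂)).wedge
          ((centreToMidQuot_shortExact h₃).wedge e g)
          ((cokerQuotMapRight_shortExact h₁ h₂).wedge f h) := by
  refine wedge_wedge_comm _ _ _ _ _ _ ?_ ?_ ?_ ?_ e f g h <;> ext x <;> rfl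

/-! ### Associativity of the composition isomorphisms -/

/-- The formula that characterizes the composition isomorphism, with the wedge products replaced by
elements equal to them. -/
theorem compIso_apply_of_eq (h₁ : D₁.IsFredholm) (h₂ : D₂.IsFredholm) {x : TopExt D₁.ker}
    {u : TopExt (KerQuot D₁ D₂)} {v : TopExt (MidQuot D₁ D₂)} {w : TopExt (CokerQuot D₁ D₂)}
    {y : TopExt (X₃ ⧸ D₂.range)} (hx : x ≠ 0) (hu : u ≠ 0) (hv : v ≠ 0) (hw : w ≠ 0) (hy : y ≠ 0)
    {p : TopExt (X₂ ⧸ D₁.range)} (hp : (coker_shortExact h₁).wedge v w = p)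
    {q : TopExt D₂.ker} (hq : (ker_shortExact h₂).wedge u v = q) {z : DetLine (D₂ ∘L D₁)}
    (hz : (kerComp_shortExact h₁ h₂).wedge x u ⊗ₜ
      dualVec ((cokerComp_shortExact h₁ h₂).wedge w y) = z) :
    compIso h₁ h₂ ((x ⊗ₜ dualVec p) ⊗ₜ (q ⊗ₜ dualVec y)) = (-1 : ℝ) ^ signExp D₁ D₂ • z := by
  rw [← hp, ← hq, ← hz]
  exact compIso_spec h₁ h₂ x u v w y hx hu hv hw hy

variable {a : TopExt D₁.ker} {b : TopExt (KerQuot D₁ D₂)} {c : TopExt (KerQuot (D₂ ∘L D₁) D₃)}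
  {d : TopExt (MidQuot D₁ D₂)} {e : TopExt (CentreQuot D₁ D₂ D₃)}
  {f : TopExt (CokerQuot D₁ (D₃ ∘L D₂))} {g : TopExt (MidQuot D₂ D₃)}
  {h : TopExt (CokerQuot D₂ D₃)} {k : TopExt (X₄ ⧸ D₃.range)}

/-- `λ(D₁) ⊗ λ(D₂) → λ(D₂ D₁)` on the generators, with the target regrouped for composition with
`D₃`. -/
theorem compIso_left_inner (h₁ : D₁.IsFredholm) (h₂ : D₂.IsFredholm) (h₃ : D₃.IsFredholm)
    (ha : a ≠ 0) (hb : b ≠ 0) (hd : d ≠ 0) (he : e ≠ 0) (hf : f ≠ 0) (hg : g ≠ 0) (hh : h ≠ 0) :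
    compIso h₁ h₂
        ((a ⊗ₜ dualVec ((coker_shortExact h₁).wedge d ((cokerQuot_shortExact h₁).wedge e f))) ⊗ₜ
          ((ker_shortExact h₂).wedge b d ⊗ₜ dualVec ((coker_shortExact h₂).wedge g h))) =
      (-1 : ℝ) ^ signExp D₁ D₂ •
        (-1 : ℝ) ^ (finrank ℝ (CokerQuot D₁ (D₃ ∘L D₂)) * finrank ℝ (MidQuot D₂ D₃)) •
          ((kerComp_shortExact h₁ h₂).wedge a b ⊗ₜ
            dualVec ((coker_shortExact (isFredholm_comp h₁ h₂)).wedge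
              ((centreToMidQuot_shortExact h₃).wedge e g)
              ((cokerQuotMapRight_shortExact h₁ h₂).wedge f h))) := by
  have := (isFredholm_comp h₁ h₂).finite_coker
  exact compIso_apply_of_eq h₁ h₂ ha hb hd ((cokerQuot_shortExact h₁).wedge_ne_zero he hf)
    ((coker_shortExact h₂).wedge_ne_zero hg hh) rfl rfl
      (tmul_dualVec_neg_one_pow_smul (finrank_topExt _) _
        ((coker_shortExact (isFredholm_comp h₁ h₂)).wedge_ne_zero
          ((centreToMidQuot_shortExact h₃).wedge_ne_zero he hg)
          ((cokerQuotMapRight_shortExact h₁ h₂).wedge_ne_zero hf hh))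
        (coker_wedge_comm h₁ h₂ h₃ e f g h))

/-- `λ(D₂ D₁) ⊗ λ(D₃) → λ(D₃ D₂ D₁)` on the generators. The value is written
with the wedge products of the pair `D₁`, `D₃ ∘ D₂`: the determinant lines of `D₃ ∘ (D₂ ∘ D₁)` and
`(D₃ ∘ D₂) ∘ D₁` are definitionally equal. -/
theorem compIso_left_outer (h₁ : D₁.IsFredholm) (h₂ : D₂.IsFredholm) (h₃ : D₃.IsFredholm)
    (ha : a ≠ 0) (hb : b ≠ 0) (hc : c ≠ 0) (he : e ≠ 0) (hf : f ≠ 0) (hg : g ≠ 0) (hh : h ≠ 0)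
    (hk : k ≠ 0) :
    compIso (isFredholm_comp h₁ h₂) h₃
        (((kerComp_shortExact h₁ h₂).wedge a b ⊗ₜ
            dualVec ((coker_shortExact (isFredholm_comp h₁ h₂)).wedge
              ((centreToMidQuot_shortExact h₃).wedge e g)
              ((cokerQuotMapRight_shortExact h₁ h₂).wedge f h))) ⊗ₜ
          ((ker_shortExact h₃).wedge c ((centreToMidQuot_shortExact h₃).wedge e g) ⊗ₜ
            dualVec k)) =
      (-1 : ℝ) ^ signExp (D₂ ∘L D₁) D₃ •
        ((kerComp_shortExact h₁ (isFredholm_comp h₂ h₃)).wedge a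
            ((kerQuot_shortExact h₁ h₂ h₃).wedge b c) ⊗ₜ
          dualVec ((cokerComp_shortExact h₁ (isFredholm_comp h₂ h₃)).wedge f
            ((cokerComp_shortExact h₂ h₃).wedge h k)) : DetLine ((D₃ ∘L D₂) ∘L D₁)) :=
  compIso_apply_of_eq (isFredholm_comp h₁ h₂) h₃ ((kerComp_shortExact h₁ h₂).wedge_ne_zero ha hb)
    hc ((centreToMidQuot_shortExact h₃).wedge_ne_zero he hg)
    ((cokerQuotMapRight_shortExact h₁ h₂).wedge_ne_zero hf hh) hk rfl rfl
    (congrArg₂ (fun p q => p ⊗ₜ dualVec q) (kerComp_wedge_assoc h₁ h₂ h₃ a b c)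
      (cokerComp_wedge_assoc h₁ h₂ h₃ f h k))

/-- `λ(D₂) ⊗ λ(D₃) → λ(D₃ D₂)` on the generators, with the target regrouped for composition with
`D₁`. -/
theorem compIso_right_inner (h₁ : D₁.IsFredholm) (h₂ : D₂.IsFredholm) (h₃ : D₃.IsFredholm)
    (hb : b ≠ 0) (hc : c ≠ 0) (hd : d ≠ 0) (he : e ≠ 0) (hg : g ≠ 0) (hh : h ≠ 0)
    (hk : k ≠ 0) :
    compIso h₂ h₃
        (((ker_shortExact h₂).wedge b d ⊗ₜ dualVec ((coker_shortExact h₂).wedge g h)) ⊗ₜ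
          ((ker_shortExact h₃).wedge c ((centreToMidQuot_shortExact h₃).wedge e g) ⊗ₜ
            dualVec k)) =
      (-1 : ℝ) ^ signExp D₂ D₃ •
        (-1 : ℝ) ^ (finrank ℝ (MidQuot D₁ D₂) * finrank ℝ (KerQuot (D₂ ∘L D₁) D₃)) •
          ((ker_shortExact (isFredholm_comp h₂ h₃)).wedge
              ((kerQuot_shortExact h₁ h₂ h₃).wedge b c)
              ((midQuotIncl_shortExact h₂ h₃).wedge d e) ⊗ₜ
            dualVec ((cokerComp_shortExact h₂ h₃).wedge h k)) :=
  compIso_apply_of_eq h₂ h₃ ((ker_shortExact h₂).wedge_ne_zero hb hd)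
    ((kerQuotMapLeft_shortExact h₂ h₃).wedge_ne_zero hc he) hg hh hk rfl
    (ker_wedge_assoc h₂ h₃ c e g)
    ((congrArg (· ⊗ₜ _) (ker_wedge_comm h₁ h₂ h₃ b d c e)).trans
      (TensorProduct.smul_tmul' _ _ _).symm)

/-- `λ(D₁) ⊗ λ(D₃ D₂) → λ(D₃ D₂ D₁)` on the generators. -/
theorem compIso_right_outer (h₁ : D₁.IsFredholm) (h₂ : D₂.IsFredholm) (h₃ : D₃.IsFredholm)
    (ha : a ≠ 0) (hb : b ≠ 0) (hc : c ≠ 0) (hd : d ≠ 0) (he : e ≠ 0) (hf : f ≠ 0) (hh : h ≠ 0)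
    (hk : k ≠ 0) :
    compIso h₁ (isFredholm_comp h₂ h₃)
        ((a ⊗ₜ dualVec ((coker_shortExact h₁).wedge d ((cokerQuot_shortExact h₁).wedge e f))) ⊗ₜ
          ((ker_shortExact (isFredholm_comp h₂ h₃)).wedge
              ((kerQuot_shortExact h₁ h₂ h₃).wedge b c)
              ((midQuotIncl_shortExact h₂ h₃).wedge d e) ⊗ₜ
            dualVec ((cokerComp_shortExact h₂ h₃).wedge h k))) =
      (-1 : ℝ) ^ signExp D₁ (D₃ ∘L D₂) •
        ((kerComp_shortExact h₁ (isFredholm_comp h₂ h₃)).wedge a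
            ((kerQuot_shortExact h₁ h₂ h₃).wedge b c) ⊗ₜ
          dualVec ((cokerComp_shortExact h₁ (isFredholm_comp h₂ h₃)).wedge f
            ((cokerComp_shortExact h₂ h₃).wedge h k))) :=
  compIso_apply_of_eq h₁ (isFredholm_comp h₂ h₃) ha
    ((kerQuot_shortExact h₁ h₂ h₃).wedge_ne_zero hb hc)
    ((midQuotIncl_shortExact h₂ h₃).wedge_ne_zero hd he) hf
    ((cokerComp_shortExact h₂ h₃).wedge_ne_zero hh hk) (coker_wedge_assoc h₁ h₂ h₃ d e f) rfl rfl

/-- Associativity, given generators of the nine lines. They occur in the proof only, through the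
element `a ⊗ (d ∧ e ∧ f)^* ⊗ (b ∧ d) ⊗ (g ∧ h)^* ⊗ (c ∧ e ∧ g) ⊗ k^*` on which the two composites
are compared. -/
theorem compIso_assoc_of_ne_zero (h₁ : D₁.IsFredholm) (h₂ : D₂.IsFredholm) (h₃ : D₃.IsFredholm)
    (ha : a ≠ 0) (hb : b ≠ 0) (hc : c ≠ 0) (hd : d ≠ 0) (he : e ≠ 0) (hf : f ≠ 0) (hg : g ≠ 0)
    (hh : h ≠ 0) (hk : k ≠ 0) :
    TensorProduct.congr (compIso h₁ h₂) (LinearEquiv.refl ℝ (DetLine D₃)) ≪≫ₗ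
        compIso (isFredholm_comp h₁ h₂) h₃ =
      TensorProduct.assoc ℝ (DetLine D₁) (DetLine D₂) (DetLine D₃) ≪≫ₗ
        TensorProduct.congr (LinearEquiv.refl ℝ (DetLine D₁)) (compIso h₂ h₃) ≪≫ₗ
          compIso h₁ (isFredholm_comp h₂ h₃) := by
  have := h₁.finite_ker
  have := h₁.finite_coker
  have := h₂.finite_ker
  have := h₂.finite_coker
  have := h₃.finite_ker
  have := h₃.finite_coker
  exact congr_trans_eq_of_apply_tmul
    (exists_smul_tmul_dualVec_eq (finrank_topExt _) (finrank_topExt _) ha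
      ((coker_shortExact h₁).wedge_ne_zero hd ((cokerQuot_shortExact h₁).wedge_ne_zero he hf)))
    (exists_smul_tmul_dualVec_eq (finrank_topExt _) (finrank_topExt _)
      ((ker_shortExact h₂).wedge_ne_zero hb hd) ((coker_shortExact h₂).wedge_ne_zero hg hh))
    (exists_smul_tmul_dualVec_eq (finrank_topExt _) (finrank_topExt _)
      ((ker_shortExact h₃).wedge_ne_zero hc ((centreToMidQuot_shortExact h₃).wedge_ne_zero he hg))
      hk)
    (compIso_left_inner h₁ h₂ h₃ ha hb hd he hf hg hh)
    (compIso_left_outer h₁ h₂ h₃ ha hb hc he hf hg hh hk)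
    (compIso_right_inner h₁ h₂ h₃ hb hc hd he hg hh hk)
    (compIso_right_outer h₁ h₂ h₃ ha hb hc hd he hf hh hk)
    (neg_one_zpow_signExp h₁ h₂ h₃)

end Triple

end FredholmDet

end

open FredholmDet in
theorem mainTheorem3 {X₁ X₂ X₃ X₄ : Type*}
    [NormedAddCommGroup X₁] [NormedSpace ℝ X₁] [CompleteSpace X₁]
    [NormedAddCommGroup X₂] [NormedSpace ℝ X₂] [CompleteSpace X₂]
    [NormedAddCommGroup X₃] [NormedSpace ℝ X₃] [CompleteSpace X₃]
    [NormedAddCommGroup X₄] [NormedSpace ℝ X₄] [CompleteSpace X₄]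
    (D₁ : X₁ →L[ℝ] X₂) (D₂ : X₂ →L[ℝ] X₃) (D₃ : X₃ →L[ℝ] X₄)
    (h₁ : D₁.IsFredholm) (h₂ : D₂.IsFredholm) (h₃ : D₃.IsFredholm) :
    TensorProduct.congr (compIso h₁ h₂) (LinearEquiv.refl ℝ (DetLine D₃)) ≪≫ₗ
        compIso (isFredholm_comp h₁ h₂) h₃ =
      TensorProduct.assoc ℝ (DetLine D₁) (DetLine D₂) (DetLine D₃) ≪≫ₗ
        TensorProduct.congr (LinearEquiv.refl ℝ (DetLine D₁)) (compIso h₂ h₃) ≪≫ₗ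
          compIso h₁ (isFredholm_comp h₂ h₃) := by
  have := h₁.finite_ker
  have := h₃.finite_coker
  have := (kerQuot_shortExact h₁ h₂ h₃).finite_left
  have := (kerQuot_shortExact h₁ h₂ h₃).finite_right
  have := (midQuotIncl_shortExact (D₁ := D₁) h₂ h₃).finite_left
  have := (midQuotIncl_shortExact (D₁ := D₁) h₂ h₃).finite_right
  have := (cokerQuot_shortExact (D₂ := D₂) (D₃ := D₃) h₁).finite_right
  have := (centreToMidQuot_shortExact (D₁ := D₁) (D₂ := D₂) h₃).finite_right
  have := (cokerQuotMapRight_shortExact (D₃ := D₃) h₁ h₂).finite_right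
  exact (exists_ne_zero_topExt D₁.ker).elim fun _ ha =>
    (exists_ne_zero_topExt (KerQuot D₁ D₂)).elim fun _ hb =>
    (exists_ne_zero_topExt (KerQuot (D₂ ∘L D₁) D₃)).elim fun _ hc =>
    (exists_ne_zero_topExt (MidQuot D₁ D₂)).elim fun _ hd =>
    (exists_ne_zero_topExt (CentreQuot D₁ D₂ D₃)).elim fun _ he =>
    (exists_ne_zero_topExt (CokerQuot D₁ (D₃ ∘L D₂))).elim fun _ hf =>
    (exists_ne_zero_topExt (MidQuot D₂ D₃)).elim fun _ hg =>
    (exists_ne_zero_topExt (CokerQuot D₂ D₃)).elim fun _ hh =>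
    (exists_ne_zero_topExt (X₄ ⧸ D₃.range)).elim fun _ hk =>
      compIso_assoc_of_ne_zero h₁ h₂ h₃ ha hb hc hd he hf hg hh hk
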